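/- Let $f:\mathbb R\to\mathbb R$ be of class $C^3$ and consider the generalized inviscid Burgers equation $U_\tau=f(U)\,U_x$ for real $U(x,\tau)$, $x\in\mathbb R/\mathbb Z$, with initial datum $U_0$. Assume: (i) $U_0$ is a real trigonometric polynomial of zero mean, $U_0(x)=\sum_{n=-M}^{M}c_n e^{2\pi i n x}$ with $M$ finite and $c_0=0$; (ii) the function $\frac{d}{dx}f(U_0(x))$ attains its absolute maximum at only finitely many points $x_1,\dots,x_m$ of $[0,1)$; (iii) $\gamma_j:=\frac{d^3}{dx^3}f(U_0(x))\big|_{x=x_j}\neq 0$ for $j=1,\dots,m$. Define the shock time $\tau_s$ by $\frac1{\tau_s}=\max_x\frac{d}{dx}f(U_0(x))$, and put $$A_k=\sum_{j=1}^m\frac{U_0'(x_j)\,e^{-2\pi i k[x_j-\tau_s f(U_0(x_j))]}}{(9\pi\tau_s|\gamma_j|)^{1/3}\,\Gamma(2/3)} .$$ Then $0<\tau_s<\infty$. There exists a solution $U$, that is, a function which is $1$-periodic in $x$, continuous on $\mathbb R\times[0,\tau_s]$, of class $C^1$ and satisfying the equation on $\mathbb R\times(0,\tau_s)$, with $U(\cdot,0)=U_0$.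 For every such solution, the Fourier coefficients $\hat U_k(\tau_s)=\int_0^1U(x,\tau_s)e^{-2\pi i kx}\,dx$ satisfy, as $k\to+\infty$, $$\hat U_k(\tau_s)=-i\,A_k\,k^{-4/3}+o(k^{-4/3}),\qquad |\hat U_k(\tau_s)|^2=|A_k|^2\,k^{-8/3}+o(k^{-8/3}).$$ For every $\delta>0$, $|\hat U_k(\tau_s)|^2/(|A_k|^2k^{-8/3})\to1$ as $k\to\infty$ along the integers $k$ with $|A_k|\ge\delta$; if $m=1$, this ratio tends to $1$ as $k\to\infty$ through all integers. Moreover the order $k^{-8/3}$ is exact in the following sense: there are constants $a,b>0$ such that for all sufficiently large $k$ one has $|\hat U_k(\tau_s)|^2\le b\,k^{-8/3}$, and at least one of the $m$ consecutive integers $l=k,k+1,\dots,k+m-1$ satisfies $|\hat U_l(\tau_s)|^2\ge a\,l^{-8/3}$ (so for $m=1$ the two-sided bound holds for all large $k$). -/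

import Mathlib

open Filter Set Asymptotics

noncomputable section

/-- The shock time `τ_s` of `U_τ = f(U) U_x`, `U(0, ·) = U₀`:
`1 / τ_s = max_x d/dx f(U₀(x))`. -/
def shockTime (f U₀ : ℝ → ℝ) : ℝ :=
  (⨆ x : ℝ, deriv (fun y => f (U₀ y)) x)⁻¹

/-- `U τ x` is a classical solution on the circle `ℝ / ℤ` of the generalized Burgers equation
`U_τ = f(U) U_x` for times `0 < τ < T` with initial datum `U₀`, extended continuously
to the closed time interval `[0, T]`. -/
structure IsBurgersSolution (f U₀ : ℝ → ℝ) (T : ℝ) (U : ℝ → ℝ → ℝ) : Prop where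
  periodic : ∀ τ ∈ Icc 0 T, Function.Periodic (U τ) 1
  continuousOn : ContinuousOn (Function.uncurry U) (Icc 0 T ×ˢ univ)
  contDiffOn : ContDiffOn ℝ 1 (Function.uncurry U) (Ioo 0 T ×ˢ univ)
  initial : ∀ x, U 0 x = U₀ x
  equation : ∀ τ ∈ Ioo 0 T, ∀ x,
    deriv (fun t => U t x) τ = f (U τ x) * deriv (U τ) x

/-- The `k`-th Fourier coefficient `∫₀¹ u(x) e^{-2πikx} dx` of a real function of period `1`. -/
def fourierMode (u : ℝ → ℝ) (k : ℕ) : ℂ :=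
  fourierCoeffOn (zero_lt_one : (0 : ℝ) < 1) (fun x => (u x : ℂ)) (k : ℤ)

/-- The amplitude
`∑_{y ∈ S} U₀'(y) e^{-2πik[y - τ_s f(U₀(y))]} / ((9π τ_s |γ_y|)^{1/3} Γ(2/3))`,
where `γ_y` is the third derivative of `f ∘ U₀` at `y`. -/
def shockAmplitude (f U₀ : ℝ → ℝ) (S : Finset ℝ) (k : ℕ) : ℂ :=
  ∑ y ∈ S,
    ((deriv U₀ y /
        ((9 * Real.pi * shockTime f U₀ * |iteratedDeriv 3 (fun x => f (U₀ x)) y|) ^ (1 / 3 : ℝ)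
          * Real.Gamma (2 / 3)) : ℝ) : ℂ) *
      Complex.exp (-(2 * Real.pi * Complex.I * k * ((y - shockTime f U₀ * f (U₀ y) : ℝ) : ℂ)))

end

/-!
The solution is carried by characteristics. With `g = f ∘ U₀`, a classical solution is constant
along the lines `x = y - τ g(y)`; since `T = shockTime f U₀` satisfies `T g' ≤ 1` with equality
only at isolated points, the maps `y ↦ y - τ g(y)` are increasing bijections of the line for
`0 ≤ τ ≤ T`. Transporting `U₀` along them gives a solution (`isBurgersSolution_charFoot`), and
every solution satisfies `U T (φ y) = U₀ y` with `φ y = y - T g(y)`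
(`IsBurgersSolution.apply_charLine`).

The substitution `x = φ y` and an integration by parts turn the Fourier coefficient at the shock
time into `(2πik)⁻¹ ∫₀¹ U₀'(y) exp (-2πik φ(y)) dy` (`fourierMode_eq_integral_deriv`). The phase
satisfies `φ' ≥ 0`, and its critical points are the maximum points of `g'`; there `φ'' = 0` and
`φ''' = T |g'''| > 0`. So this is a stationary phase integral with cubic critical points. At the
scale `lam ^ (-1/3)` around a critical point the integral converges to a truncation of
`∫ exp (-iκs³) ds`, and integration by parts shows that everything at distance more than
`R lam ^ (-1/3)` contributes only `O(R⁻² lam ^ (-1/3))`; letting `R → ∞` gives the leading term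
(`IsCubicPoint.tendsto_integral_right`, `isLittleO_integral_sub_sum`). The model integral is a
Gamma integral continued to the imaginary axis (`norm_integral_sub_cubicFresnel_le`).

The amplitude is an exponential sum in `k` with `#S` distinct frequencies, because `φ` is
injective modulo one, and with nonzero coefficients, because `f'(U₀) U₀' = g' > 0` at the
maximum points. A Lagrange basis polynomial in the shift of `k` isolates one frequency, so that
among `#S` consecutive amplitudes one is bounded below (`exists_le_norm_sum_mul_pow`).
-/

open Topology MeasureTheory

/-! ### Integration by parts in oscillatory integrals -/

theorem integral_mul_deriv_mul_exp {φ φ₁ w w₁ : ℝ → ℝ} {p q : ℝ} {r : ℂ}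
    (hr : r ≠ 0)
    (hφ : ∀ y ∈ uIcc p q, HasDerivAt φ (φ₁ y) y) (hφ₁ : ContinuousOn φ₁ (uIcc p q))
    (hw : ∀ y ∈ uIcc p q, HasDerivAt w (w₁ y) y) (hw₁ : ContinuousOn w₁ (uIcc p q)) :
    ∫ y in p..q, ((w y * φ₁ y : ℝ) : ℂ) * Complex.exp (-(r * φ y)) =
      -r⁻¹ * (w q * Complex.exp (-(r * φ q)) - w p * Complex.exp (-(r * φ p))
        - ∫ y in p..q, (w₁ y : ℂ) * Complex.exp (-(r * φ y))) := by
  have hE : ∀ y ∈ uIcc p q, HasDerivAt (fun y => -r⁻¹ * Complex.exp (-(r * φ y)))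
      (φ₁ y * Complex.exp (-(r * φ y))) y := by
    intro y hy
    have h := ((((hφ y hy).ofReal_comp.const_mul r).neg).cexp).const_mul (-r⁻¹)
    refine h.congr_deriv ?_
    simp only [neg_mul, Pi.neg_apply]
    field_simp
  have hφc : ContinuousOn φ (uIcc p q) := fun y hy => (hφ y hy).continuousAt.continuousWithinAt
  have hEc : ContinuousOn (fun y => Complex.exp (-(r * φ y))) (uIcc p q) :=
    (((Complex.continuous_ofReal.comp_continuousOn hφc).const_smul r).neg).cexp
  have key := intervalIntegral.integral_mul_deriv_eq_deriv_mul
    (u := fun y => (w y : ℂ)) (u' := fun y => (w₁ y : ℂ))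
    (v := fun y => -r⁻¹ * Complex.exp (-(r * φ y)))
    (v' := fun y => φ₁ y * Complex.exp (-(r * φ y)))
    (fun y hy => (hw y hy).ofReal_comp) hE
    (Complex.continuous_ofReal.comp_continuousOn hw₁).intervalIntegrable
    ((Complex.continuous_ofReal.comp_continuousOn hφ₁).mul hEc).intervalIntegrable
  have h1 : ∫ y in p..q, ((w y * φ₁ y : ℝ) : ℂ) * Complex.exp (-(r * φ y)) =
      ∫ y in p..q, (w y : ℂ) * (φ₁ y * Complex.exp (-(r * φ y))) := by
    congr 1; ext y; push_cast; ring
  have h2 : ∫ y in p..q, (w₁ y : ℂ) * (-r⁻¹ * Complex.exp (-(r * φ y))) =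
      -r⁻¹ * ∫ y in p..q, (w₁ y : ℂ) * Complex.exp (-(r * φ y)) := by
    rw [← intervalIntegral.integral_const_mul]
    congr 1; ext y; ring
  rw [h1, key, h2]; ring

theorem norm_exp_neg_mul_le_one {r : ℂ} {x : ℝ} (h : 0 ≤ r.re * x) :
    ‖Complex.exp (-(r * x))‖ ≤ 1 := by
  rw [Complex.norm_exp]
  simp [h]

/-- The first derivative test for oscillatory integrals: the amplitude `a` is written as
`w φ'`, so that the bound involves the variation of `w = a / φ'`. -/
theorem norm_integral_mul_deriv_mul_exp_le {φ φ₁ w w₁ : ℝ → ℝ} {p q : ℝ} {r : ℂ}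
    (hr : r ≠ 0) (hpq : p ≤ q)
    (hφ : ∀ y ∈ Icc p q, HasDerivAt φ (φ₁ y) y) (hφ₁ : ContinuousOn φ₁ (Icc p q))
    (hw : ∀ y ∈ Icc p q, HasDerivAt w (w₁ y) y) (hw₁ : ContinuousOn w₁ (Icc p q))
    (hre : ∀ y ∈ Icc p q, 0 ≤ r.re * φ y) :
    ‖∫ y in p..q, ((w y * φ₁ y : ℝ) : ℂ) * Complex.exp (-(r * φ y))‖ ≤
      ‖r‖⁻¹ * (|w p| + |w q| + ∫ y in p..q, |w₁ y|) := by
  rw [← uIcc_of_le hpq] at hφ hφ₁ hw hw₁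
  rw [integral_mul_deriv_mul_exp hr hφ hφ₁ hw hw₁, norm_mul, norm_neg, norm_inv]
  gcongr
  have hp := norm_exp_neg_mul_le_one (hre p ⟨le_rfl, hpq⟩)
  have hq := norm_exp_neg_mul_le_one (hre q ⟨hpq, le_rfl⟩)
  have h1 : ‖(w q : ℂ) * Complex.exp (-(r * φ q))‖ ≤ |w q| := by
    rw [norm_mul, Complex.norm_real, Real.norm_eq_abs]
    exact mul_le_of_le_one_right (abs_nonneg _) hq
  have h2 : ‖(w p : ℂ) * Complex.exp (-(r * φ p))‖ ≤ |w p| := by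
    rw [norm_mul, Complex.norm_real, Real.norm_eq_abs]
    exact mul_le_of_le_one_right (abs_nonneg _) hp
  have h3 : ‖∫ y in p..q, (w₁ y : ℂ) * Complex.exp (-(r * φ y))‖ ≤ ∫ y in p..q, |w₁ y| := by
    refine intervalIntegral.norm_integral_le_of_norm_le hpq ?_ hw₁.abs.intervalIntegrable
    refine Eventually.of_forall fun y hy => ?_
    rw [norm_mul, Complex.norm_real, Real.norm_eq_abs]
    exact mul_le_of_le_one_right (abs_nonneg _)
      (norm_exp_neg_mul_le_one (hre y (Ioc_subset_Icc_self hy)))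
  calc _ ≤ ‖(w q : ℂ) * Complex.exp (-(r * φ q))‖ + ‖(w p : ℂ) * Complex.exp (-(r * φ p))‖
        + ‖∫ y in p..q, (w₁ y : ℂ) * Complex.exp (-(r * φ y))‖ :=
        (norm_sub_le _ _).trans (by gcongr; exact norm_sub_le _ _)
    _ ≤ _ := by linarith

theorem integral_div_sub_cube {z p q : ℝ} (hz : z < p) (hpq : p ≤ q) (D : ℝ) :
    ∫ y in p..q, D / (y - z) ^ 3 = D / 2 * (1 / (p - z) ^ 2 - 1 / (q - z) ^ 2) := by
  have hne : ∀ y ∈ uIcc p q, y - z ≠ 0 := by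
    intro y hy
    rw [uIcc_of_le hpq] at hy
    exact (sub_pos.2 (hz.trans_le hy.1)).ne'
  rw [intervalIntegral.integral_eq_sub_of_hasDerivAt (f := fun y => -(D / 2) / (y - z) ^ 2)]
  · ring
  · intro y hy
    have h := hne y hy
    have h1 : HasDerivAt (fun y => (y - z) ^ 2) (2 * (y - z)) y := by
      simpa using ((hasDerivAt_id' y).sub_const z).fun_pow 2
    refine ((hasDerivAt_const y (-(D / 2))).div h1 (pow_ne_zero 2 h)).congr_deriv ?_
    field_simp
    ring
  · apply ContinuousOn.intervalIntegrable
    exact continuousOn_const.div (by fun_prop) fun y hy => pow_ne_zero 3 (hne y hy)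

/-- If the quotient `w` of amplitude and phase derivative blows up no faster than at a
cubic critical point `z`, the part of the integral at distance at least `p - z` from `z` is
`O(1 / (‖r‖ (p - z) ^ 2))`, uniformly in the other end point. -/
theorem norm_integral_le_of_cubic {φ φ₁ w w₁ : ℝ → ℝ} {z p q D : ℝ} {r : ℂ}
    (hr : r ≠ 0) (hz : z < p) (hpq : p ≤ q)
    (hφ : ∀ y ∈ Icc p q, HasDerivAt φ (φ₁ y) y) (hφ₁ : ContinuousOn φ₁ (Icc p q))
    (hw : ∀ y ∈ Icc p q, HasDerivAt w (w₁ y) y) (hw₁ : ContinuousOn w₁ (Icc p q))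
    (hre : ∀ y ∈ Icc p q, 0 ≤ r.re * φ y)
    (hD : ∀ y ∈ Icc p q, |w y| ≤ D / (y - z) ^ 2)
    (hD₁ : ∀ y ∈ Icc p q, |w₁ y| ≤ D / (y - z) ^ 3) :
    ‖∫ y in p..q, ((w y * φ₁ y : ℝ) : ℂ) * Complex.exp (-(r * φ y))‖ ≤
      3 * D / (‖r‖ * (p - z) ^ 2) := by
  refine (norm_integral_mul_deriv_mul_exp_le hr hpq hφ hφ₁ hw hw₁ hre).trans ?_
  have hpz : 0 < p - z := sub_pos.2 hz
  have hqz : p - z ≤ q - z := by linarith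
  have hD0 : 0 ≤ D := by
    have h := (abs_nonneg _).trans (hD p ⟨le_rfl, hpq⟩)
    by_contra hneg
    exact absurd h (not_le.2 (div_neg_of_neg_of_pos (not_le.1 hneg) (by positivity)))
  have h1 := hD p ⟨le_rfl, hpq⟩
  have h2 : |w q| ≤ D / (p - z) ^ 2 := (hD q ⟨hpq, le_rfl⟩).trans (by gcongr)
  have h3 : ∫ y in p..q, |w₁ y| ≤ D / (p - z) ^ 2 := by
    calc ∫ y in p..q, |w₁ y| ≤ ∫ y in p..q, D / (y - z) ^ 3 := by
          refine intervalIntegral.integral_mono_on hpq ?_ ?_ hD₁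
          · rw [← uIcc_of_le hpq] at hw₁
            exact hw₁.abs.intervalIntegrable
          · apply ContinuousOn.intervalIntegrable
            rw [uIcc_of_le hpq]
            exact continuousOn_const.div (by fun_prop) fun y hy =>
              pow_ne_zero 3 (sub_pos.2 (hz.trans_le hy.1)).ne'
      _ = D / 2 * (1 / (p - z) ^ 2 - 1 / (q - z) ^ 2) := integral_div_sub_cube hz hpq D
      _ ≤ D / 2 * (1 / (p - z) ^ 2) := by
          gcongr
          have : 0 ≤ 1 / (q - z) ^ 2 := by positivity
          linarith
      _ ≤ D / (p - z) ^ 2 := by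
          rw [mul_one_div]; gcongr; linarith
  calc ‖r‖⁻¹ * (|w p| + |w q| + ∫ y in p..q, |w₁ y|)
      ≤ ‖r‖⁻¹ * (D / (p - z) ^ 2 + D / (p - z) ^ 2 + D / (p - z) ^ 2) := by gcongr
    _ = 3 * D / (‖r‖ * (p - z) ^ 2) := by
        rw [mul_comm ‖r‖, ← div_div, div_eq_mul_inv _ ‖r‖]; ring

/-! ### The cubic Fresnel integral -/

/-- The value `Γ(1/3) / 3 · (iκ) ^ (-1/3)` of the conditionally convergent integral
`∫₀^∞ e ^ (-iκs³) ds`, the contribution of one side of a cubic critical point. -/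
noncomputable def cubicFresnel (κ : ℝ) : ℂ :=
  (1 / 3) * ((1 / (Complex.I * κ)) ^ (1 / 3 : ℂ) * Complex.Gamma (1 / 3))

theorem integrableOn_exp_neg_mul_cube {r : ℂ} (hr : 0 < r.re) :
    IntegrableOn (fun s : ℝ => Complex.exp (-(r * (s ^ 3 : ℝ)))) (Ioi 0) := by
  have h := integrableOn_rpow_mul_exp_neg_mul_rpow (p := 3) (s := 0) (b := r.re) (by norm_num)
    (by norm_num) hr
  refine (integrable_norm_iff (by fun_prop)).1 (h.congr ?_)
  refine (ae_restrict_mem measurableSet_Ioi).mono fun s (hs : 0 < s) => ?_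
  have h4 : (s : ℝ) ^ (3 : ℝ) = s ^ 3 := by exact_mod_cast Real.rpow_natCast s 3
  have h5 : (r * (s ^ 3 : ℝ)).re = r.re * s ^ 3 := Complex.re_mul_ofReal _ _
  simp only [Complex.norm_exp, Real.rpow_zero, one_mul, h4, Complex.neg_re, h5, neg_mul]

theorem integral_Ioi_exp_neg_mul_cube_ofReal {r : ℝ} (hr : 0 < r) :
    ∫ s in Ioi (0 : ℝ), Complex.exp (-(r * (s ^ 3 : ℝ))) =
      (1 / 3) * ((1 / r) ^ (1 / 3 : ℂ) * Complex.Gamma (1 / 3)) := by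
  have h1 := Complex.integral_cpow_mul_exp_neg_mul_Ioi (a := 1 / 3) (r := r) (by norm_num) hr
  have h2 := integral_comp_rpow_Ioi_of_pos
    (g := fun t : ℝ => (t : ℂ) ^ ((1 / 3 : ℂ) - 1) * Complex.exp (-(r * t))) (p := 3) (by norm_num)
  rw [h1] at h2
  rw [← h2, ← integral_const_mul]
  refine setIntegral_congr_fun measurableSet_Ioi fun s (hs : 0 < s) => ?_
  have h3 : ((s ^ (3 : ℝ) : ℝ) : ℂ) ^ ((1 / 3 : ℂ) - 1) = ((s ^ (2 : ℝ) : ℝ) : ℂ)⁻¹ := by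
    rw [show ((1 / 3 : ℂ) - 1) = ((-(2 / 3) : ℝ) : ℂ) by push_cast; norm_num,
      ← Complex.ofReal_cpow (by positivity), ← Complex.ofReal_inv, ← Real.rpow_mul hs.le,
      ← Real.rpow_neg hs.le]
    norm_num
  have h4 : (s : ℝ) ^ (3 : ℝ) = s ^ 3 := by exact_mod_cast Real.rpow_natCast s 3
  have h5 : (s : ℝ) ^ (2 : ℝ) = s ^ 2 := by exact_mod_cast Real.rpow_natCast s 2
  have h6 : (s : ℝ) ^ ((3 : ℝ) - 1) = s ^ 2 := by rw [← h5]; norm_num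
  rw [h3, h4, h5, h6, Complex.real_smul]
  have : (s : ℂ) ≠ 0 := by exact_mod_cast hs.ne'
  push_cast
  field_simp

theorem differentiableOn_integral_exp_neg_mul_cube :
    DifferentiableOn ℂ (fun r : ℂ => ∫ s in Ioi (0 : ℝ), Complex.exp (-(r * (s ^ 3 : ℝ))))
      {r | 0 < r.re} := by
  intro r₀ (hr₀ : 0 < r₀.re)
  have hhalf : 0 < r₀.re / 2 := half_pos hr₀
  have hball : ∀ r ∈ Metric.ball r₀ (r₀.re / 2), r₀.re / 2 < r.re := by
    intro r hr
    have h1 := Complex.abs_re_le_norm (r - r₀)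
    rw [Metric.mem_ball, dist_eq_norm] at hr
    have h2 := (abs_lt.1 (h1.trans_lt hr)).1
    rw [Complex.sub_re] at h2
    linarith
  have hbd : IntegrableOn (fun s : ℝ => s ^ 3 * Real.exp (-(r₀.re / 2) * s ^ 3)) (Ioi 0) := by
    refine (integrableOn_rpow_mul_exp_neg_mul_rpow (p := 3) (s := 3) (b := r₀.re / 2)
      (by norm_num) (by norm_num) hhalf).congr_fun (fun s _ => ?_) measurableSet_Ioi
    have h4 : (s : ℝ) ^ (3 : ℝ) = s ^ 3 := by exact_mod_cast Real.rpow_natCast s 3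
    simp only [h4]
  have h := hasDerivAt_integral_of_dominated_loc_of_deriv_le
    (μ := volume.restrict (Ioi (0 : ℝ)))
    (F := fun (r : ℂ) (s : ℝ) => Complex.exp (-(r * (s ^ 3 : ℝ))))
    (F' := fun (r : ℂ) (s : ℝ) => Complex.exp (-(r * (s ^ 3 : ℝ))) * -(s ^ 3 : ℝ))
    (x₀ := r₀) (Metric.ball_mem_nhds r₀ hhalf)
    (Eventually.of_forall fun r => Continuous.aestronglyMeasurable (by fun_prop))
    (integrableOn_exp_neg_mul_cube hr₀)
    (Continuous.aestronglyMeasurable (by fun_prop))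
    (bound := fun s : ℝ => s ^ 3 * Real.exp (-(r₀.re / 2) * s ^ 3))
    ((ae_restrict_mem measurableSet_Ioi).mono fun s (hs : 0 < s) r hr => by
      have h5 : (r * (s ^ 3 : ℝ)).re = r.re * s ^ 3 := Complex.re_mul_ofReal _ _
      rw [norm_mul, norm_neg, Complex.norm_real, Real.norm_of_nonneg (by positivity),
        mul_comm, Complex.norm_exp, Complex.neg_re, h5]
      gcongr
      have := hball r hr
      nlinarith [pow_pos hs 3])
    hbd
    (Eventually.of_forall fun s r _ =>
      ((((hasDerivAt_id' r).mul_const ((s ^ 3 : ℝ) : ℂ)).fun_neg).cexp).congr_deriv (by ring))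
  exact h.2.differentiableAt.differentiableWithinAt

/-- Both sides are holomorphic in the right half plane and agree on the positive real axis. -/
theorem integral_Ioi_exp_neg_mul_cube {r : ℂ} (hr : 0 < r.re) :
    ∫ s in Ioi (0 : ℝ), Complex.exp (-(r * (s ^ 3 : ℝ))) =
      (1 / 3) * ((1 / r) ^ (1 / 3 : ℂ) * Complex.Gamma (1 / 3)) := by
  have hopen : IsOpen {r : ℂ | 0 < r.re} := isOpen_lt continuous_const Complex.continuous_re
  have hdiff : DifferentiableOn ℂ
      (fun r : ℂ => (1 / 3) * ((1 / r) ^ (1 / 3 : ℂ) * Complex.Gamma (1 / 3)))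
      {r | 0 < r.re} := by
    intro r (hr : 0 < r.re)
    have hr0 : r ≠ 0 := by rintro rfl; simp at hr
    refine DifferentiableAt.differentiableWithinAt ?_
    refine (DifferentiableAt.mul_const (DifferentiableAt.cpow_const ?_ ?_) _).const_mul _
    · exact (differentiableAt_const _).div differentiableAt_id hr0
    · left
      rw [one_div, Complex.inv_re]
      exact div_pos hr (Complex.normSq_pos.2 hr0)
  have hfreq : ∃ᶠ r in 𝓝[≠] (1 : ℂ), ∫ s in Ioi (0 : ℝ), Complex.exp (-(r * (s ^ 3 : ℝ))) =
      (1 / 3) * ((1 / r) ^ (1 / 3 : ℂ) * Complex.Gamma (1 / 3)) := by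
    have ht : Tendsto (fun x : ℝ => (x : ℂ)) (𝓝[≠] 1) (𝓝[≠] 1) := by
      refine tendsto_nhdsWithin_iff.2 ⟨?_, ?_⟩
      · exact (Complex.continuous_ofReal.tendsto' 1 1 (by simp)).mono_left nhdsWithin_le_nhds
      · filter_upwards [self_mem_nhdsWithin] with x hx
        simpa using hx
    refine ht.frequently (Eventually.frequently ?_)
    filter_upwards [nhdsWithin_le_nhds (lt_mem_nhds zero_lt_one)] with x hx
    exact integral_Ioi_exp_neg_mul_cube_ofReal hx
  have hconn : IsPreconnected {r : ℂ | 0 < r.re} :=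
    (convex_halfSpace_re_gt 0).isPreconnected
  exact (differentiableOn_integral_exp_neg_mul_cube.analyticOnNhd hopen
    ).eqOn_of_preconnected_of_frequently_eq (hdiff.analyticOnNhd hopen) hconn
    (by simp : (1 : ℂ) ∈ {r : ℂ | 0 < r.re}) hfreq hr

theorem norm_integral_exp_neg_mul_cube_le {r : ℂ} (hr : r ≠ 0) (hre : 0 ≤ r.re) {R R' : ℝ}
    (hR : 0 < R) (hRR' : R ≤ R') :
    ‖∫ s in R..R', Complex.exp (-(r * (s ^ 3 : ℝ)))‖ ≤ 2 / (‖r‖ * R ^ 2) := by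
  have hpos : ∀ y ∈ Icc R R', 0 < y := fun y hy => hR.trans_le hy.1
  have h := norm_integral_le_of_cubic (φ := fun s => s ^ 3) (φ₁ := fun s => 3 * s ^ 2)
    (w := fun s => 1 / (3 * s ^ 2)) (w₁ := fun s => -2 / (3 * s ^ 3)) (z := 0) (D := 2 / 3)
    hr hR hRR'
    (fun y _ => by simpa using hasDerivAt_pow 3 y) (by fun_prop)
    (fun y hy => by
      have h0 := (hpos y hy).ne'
      have h1 : HasDerivAt (fun s : ℝ => 3 * s ^ 2) (3 * (2 * y)) y := by
        simpa using (hasDerivAt_pow 2 y).const_mul 3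
      refine ((hasDerivAt_const y (1 : ℝ)).div h1 (by positivity)).congr_deriv ?_
      field_simp
      ring)
    (continuousOn_const.div (by fun_prop) fun y hy => by have := hpos y hy; positivity)
    (fun y hy => by have := hpos y hy; positivity)
    (fun y hy => by
      have := hpos y hy
      rw [abs_of_pos (by positivity), sub_zero, div_div]
      gcongr; norm_num)
    (fun y hy => by
      have := hpos y hy
      rw [abs_div, abs_of_pos (a := 3 * y ^ 3) (by positivity), sub_zero, div_div]
      norm_num)
  rw [sub_zero] at h
  refine le_trans (le_of_eq ?_) (h.trans (le_of_eq (by norm_num)))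
  congr 1
  refine intervalIntegral.integral_congr fun y hy => ?_
  rw [uIcc_of_le hRR'] at hy
  have := hpos y hy
  have h1 : 1 / (3 * y ^ 2) * (3 * y ^ 2) = 1 := by field_simp
  simp only [h1, Complex.ofReal_one, one_mul]

/-- The cubic Fresnel integral, with its rate of convergence: damp the integrand by
`e ^ (-ε s³)`, where the integral is an absolutely convergent Gamma integral whose tail is
bounded independently of `ε`, and let `ε → 0`. -/
theorem norm_integral_sub_cubicFresnel_le {κ R : ℝ} (hκ : 0 < κ) (hR : 0 < R) :
    ‖(∫ s in (0 : ℝ)..R, Complex.exp (-(Complex.I * κ * (s ^ 3 : ℝ)))) - cubicFresnel κ‖ ≤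
      2 / (κ * R ^ 2) := by
  set r : ℝ → ℂ := fun ε => ε + Complex.I * κ with hrdef
  have hre : ∀ ε, (r ε).re = ε := fun ε => by simp [hrdef]
  have him : ∀ ε, (r ε).im = κ := fun ε => by simp [hrdef]
  have hnorm : ∀ ε, κ ≤ ‖r ε‖ := fun ε => by
    have := Complex.abs_im_le_norm (r ε)
    rwa [him, abs_of_pos hκ] at this
  have hne : ∀ ε, r ε ≠ 0 := fun ε => norm_pos_iff.1 (hκ.trans_le (hnorm ε))
  set J : ℝ → ℂ := fun ε => ∫ s in (0 : ℝ)..R, Complex.exp (-(r ε * (s ^ 3 : ℝ))) with hJ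
  set K : ℝ → ℂ := fun ε => (1 / 3) * ((1 / r ε) ^ (1 / 3 : ℂ) * Complex.Gamma (1 / 3)) with hK
  have hbound : ∀ ε, 0 < ε → ‖J ε - K ε‖ ≤ 2 / (κ * R ^ 2) := by
    intro ε hε
    have hε' : 0 < (r ε).re := by rwa [hre]
    have hint := integrableOn_exp_neg_mul_cube hε'
    have hlim := intervalIntegral_tendsto_integral_Ioi 0 hint tendsto_id
    rw [integral_Ioi_exp_neg_mul_cube hε'] at hlim
    have hlim2 : Tendsto (fun R' => ‖J ε - ∫ s in (0 : ℝ)..R',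
        Complex.exp (-(r ε * (s ^ 3 : ℝ)))‖) atTop (𝓝 ‖J ε - K ε‖) :=
      (tendsto_const_nhds.sub hlim).norm
    refine le_of_tendsto hlim2 ((eventually_ge_atTop R).mono fun R' hR' => ?_)
    have hc : Continuous fun s : ℝ => Complex.exp (-(r ε * (s ^ 3 : ℝ))) := by fun_prop
    rw [norm_sub_rev, hJ, intervalIntegral.integral_interval_sub_left
      (hc.intervalIntegrable _ _) (hc.intervalIntegrable _ _)]
    refine (norm_integral_exp_neg_mul_cube_le (hne ε) hε'.le hR hR').trans ?_
    gcongr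
    exact hnorm ε
  have hrc : Continuous r := by fun_prop
  have hJc : Continuous J := by
    refine intervalIntegral.continuous_parametric_intervalIntegral_of_continuous' ?_ 0 R
    fun_prop
  have hKc : ContinuousAt K 0 := by
    have h1 : ContinuousAt (fun ε => (1 / r ε)) 0 :=
      continuousAt_const.div hrc.continuousAt (hne 0)
    refine continuousAt_const.mul (ContinuousAt.mul (h1.cpow continuousAt_const ?_)
      continuousAt_const)
    right
    rw [one_div, Complex.inv_im, him]
    have : 0 < Complex.normSq (r 0) := Complex.normSq_pos.2 (hne 0)
    exact (div_neg_of_neg_of_pos (neg_neg_of_pos hκ) this).ne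
  have hlim : Tendsto (fun ε => ‖J ε - K ε‖) (𝓝[>] 0) (𝓝 ‖J 0 - K 0‖) :=
    ((hJc.continuousAt.sub hKc).norm).tendsto.mono_left nhdsWithin_le_nhds
  have := le_of_tendsto hlim (eventually_mem_nhdsWithin.mono fun ε hε => hbound ε hε)
  simpa [hJ, hK, hrdef, cubicFresnel] using this

/-! ### A single cubic critical point -/

theorem exists_abs_le_of_continuousOn_Ioc {f : ℝ → ℝ} {z v l : ℝ}
    (hf : ContinuousOn f (Ioc z v)) (hl : Tendsto f (𝓝[>] z) (𝓝 l)) :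
    ∃ D, ∀ y ∈ Ioc z v, |f y| ≤ D := by
  have h1 : ∀ᶠ y in 𝓝[>] z, |f y| < |l| + 1 := hl.abs.eventually_lt_const (by linarith)
  obtain ⟨u, hu, hsub⟩ := mem_nhdsGT_iff_exists_Ioo_subset.1 h1
  obtain ⟨B, hB⟩ := isCompact_Icc.exists_bound_of_continuousOn
    (hf.mono fun y (hy : y ∈ Icc u v) => ⟨(mem_Ioi.1 hu).trans_le hy.1, hy.2⟩)
  refine ⟨max (|l| + 1) B, fun y hy => ?_⟩
  rcases lt_or_ge y u with h | h
  · exact le_max_of_le_left (hsub ⟨hy.1, h⟩).le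
  · exact le_max_of_le_right (hB y ⟨h, hy.2⟩)

/-- `z` is a nondegenerate cubic critical point of the `C²` phase `φ`, with derivatives `φ₁`
and `φ₂`: near `z` one has `φ y = φ z + κ (y - z) ^ 3 + o((y - z) ^ 3)` with `κ > 0`. -/
structure IsCubicPoint (φ φ₁ φ₂ : ℝ → ℝ) (κ z : ℝ) : Prop where
  hasDerivAt : ∀ y, HasDerivAt φ (φ₁ y) y
  hasDerivAt₁ : ∀ y, HasDerivAt φ₁ (φ₂ y) y
  continuous₂ : Continuous φ₂
  hasDerivAt₂ : HasDerivAt φ₂ (6 * κ) z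
  eq_zero₁ : φ₁ z = 0
  eq_zero₂ : φ₂ z = 0
  pos : 0 < κ

namespace IsCubicPoint

variable {φ φ₁ φ₂ a a₁ : ℝ → ℝ} {κ z u v : ℝ}

theorem tendsto_div₂ (h : IsCubicPoint φ φ₁ φ₂ κ z) :
    Tendsto (fun y => φ₂ y / (y - z)) (𝓝[≠] z) (𝓝 (6 * κ)) := by
  have := hasDerivAt_iff_tendsto_slope.1 h.hasDerivAt₂
  refine this.congr fun y => ?_
  rw [slope_def_field, h.eq_zero₂, sub_zero]

theorem tendsto_div₁ (h : IsCubicPoint φ φ₁ φ₂ κ z) :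
    Tendsto (fun y => φ₁ y / (y - z) ^ 2) (𝓝[≠] z) (𝓝 (3 * κ)) := by
  refine HasDerivAt.lhopital_zero_nhdsNE (f' := φ₂) (g' := fun y => 2 * (y - z))
    (Eventually.of_forall h.hasDerivAt₁) (Eventually.of_forall fun y => ?_) ?_ ?_ ?_ ?_
  · simpa using ((hasDerivAt_id' y).sub_const z).fun_pow 2
  · filter_upwards [self_mem_nhdsWithin] with y hy
    exact mul_ne_zero two_ne_zero (sub_ne_zero.2 hy)
  · exact ((h.hasDerivAt₁ z).continuousAt.tendsto.mono_left nhdsWithin_le_nhds).trans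
      (by rw [h.eq_zero₁])
  · exact (Continuous.tendsto' (by fun_prop) _ _ (by simp)).mono_left nhdsWithin_le_nhds
  · have := h.tendsto_div₂.const_mul (1 / 2)
    rw [show 1 / 2 * (6 * κ) = 3 * κ by ring] at this
    refine this.congr fun y => ?_
    rw [mul_comm 2, ← div_div]; ring

theorem tendsto_div (h : IsCubicPoint φ φ₁ φ₂ κ z) :
    Tendsto (fun y => (φ y - φ z) / (y - z) ^ 3) (𝓝[≠] z) (𝓝 κ) := by
  refine HasDerivAt.lhopital_zero_nhdsNE (f' := φ₁) (g' := fun y => 3 * (y - z) ^ 2)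
    (Eventually.of_forall fun y => (h.hasDerivAt y).sub_const _)
    (Eventually.of_forall fun y => ?_) ?_ ?_ ?_ ?_
  · simpa using ((hasDerivAt_id' y).sub_const z).fun_pow 3
  · filter_upwards [self_mem_nhdsWithin] with y hy
    exact mul_ne_zero three_ne_zero (pow_ne_zero 2 (sub_ne_zero.2 hy))
  · exact (((h.hasDerivAt z).continuousAt.tendsto.sub_const _).mono_left
      nhdsWithin_le_nhds).trans (by rw [sub_self])
  · exact (Continuous.tendsto' (by fun_prop) _ _ (by simp)).mono_left nhdsWithin_le_nhds
  · have := h.tendsto_div₁.const_mul (1 / 3)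
    rw [show 1 / 3 * (3 * κ) = κ by ring] at this
    refine this.congr fun y => ?_
    rw [mul_comm 3, ← div_div]; ring

/-- The part of the oscillatory integral at distance at least `ρ` to the right of a cubic
critical point is `O(1 / (lam ρ ^ 2))`. -/
theorem exists_norm_integral_le (h : IsCubicPoint φ φ₁ φ₂ κ z)
    (ha : ∀ y, HasDerivAt a (a₁ y) y) (ha₁ : Continuous a₁)
    (hne : ∀ y ∈ Ioc z v, φ₁ y ≠ 0) :
    ∃ D, ∀ lam ρ : ℝ, 0 < lam → 0 < ρ → z + ρ ≤ v →
      ‖∫ y in (z + ρ)..v, (a y : ℂ) * Complex.exp (-(Complex.I * lam * (φ y - φ z : ℝ)))‖ ≤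
        D / (lam * ρ ^ 2) := by
  have hac : Continuous a := continuous_iff_continuousAt.2 fun y => (ha y).continuousAt
  have hφ₁c : Continuous φ₁ := continuous_iff_continuousAt.2 fun y => (h.hasDerivAt₁ y).continuousAt
  set w : ℝ → ℝ := fun y => a y / φ₁ y with hw
  set w₁ : ℝ → ℝ := fun y => (a₁ y * φ₁ y - a y * φ₂ y) / φ₁ y ^ 2 with hw₁
  have hw₁c : ContinuousOn w₁ (Ioc z v) :=
    (Continuous.continuousOn (by have := h.continuous₂; fun_prop)).div (by fun_prop)
      fun y hy => pow_ne_zero 2 (hne y hy)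
  have hwc : ContinuousOn w (Ioc z v) := hac.continuousOn.div hφ₁c.continuousOn hne
  -- `w` and its derivative `w₁` blow up at `z` like `(y - z) ^ (-2)` and `(y - z) ^ (-3)`
  have hGE : 𝓝[>] z ≤ 𝓝[≠] z := nhdsGT_le_nhdsNE z
  have hinv : Tendsto (fun y => (y - z) ^ 2 / φ₁ y) (𝓝[>] z) (𝓝 (3 * κ)⁻¹) := by
    refine ((h.tendsto_div₁.mono_left hGE).inv₀ (by have := h.pos; positivity)).congr fun y => ?_
    rw [inv_div]
  have hl1 : Tendsto (fun y => w y * (y - z) ^ 2) (𝓝[>] z) (𝓝 (a z * (3 * κ)⁻¹)) := by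
    refine ((hac.continuousAt.tendsto.mono_left nhdsWithin_le_nhds).mul hinv).congr fun y => ?_
    simp only [hw]; ring
  have hz0 : Tendsto (fun y => y - z) (𝓝[>] z) (𝓝 0) :=
    (Continuous.tendsto' (by fun_prop) _ _ (by simp)).mono_left nhdsWithin_le_nhds
  have hl2 : Tendsto (fun y => w₁ y * (y - z) ^ 3) (𝓝[>] z)
      (𝓝 (a₁ z * (0 * (3 * κ)⁻¹) - a z * (6 * κ * (3 * κ)⁻¹ ^ 2))) := by
    refine (((ha₁.continuousAt.tendsto.mono_left nhdsWithin_le_nhds).mul (hz0.mul hinv)).sub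
      ((hac.continuousAt.tendsto.mono_left nhdsWithin_le_nhds).mul
        ((h.tendsto_div₂.mono_left hGE).mul (hinv.pow 2)))).congr' ?_
    have hev : ∀ᶠ y in 𝓝[>] z, φ₁ y / (y - z) ^ 2 ≠ 0 :=
      (h.tendsto_div₁.mono_left hGE).eventually_ne (by have := h.pos; positivity)
    filter_upwards [self_mem_nhdsWithin, hev] with y hy hy1
    have h0 : y - z ≠ 0 := (sub_pos.2 hy).ne'
    have h1 : φ₁ y ≠ 0 := fun h2 => hy1 (by rw [h2, zero_div])
    simp only [hw₁]
    field_simp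
  obtain ⟨D₁, hD₁⟩ := exists_abs_le_of_continuousOn_Ioc
    (hwc.mul (by fun_prop : ContinuousOn (fun y => (y - z) ^ 2) (Ioc z v))) hl1
  obtain ⟨D₂, hD₂⟩ := exists_abs_le_of_continuousOn_Ioc
    (hw₁c.mul (by fun_prop : ContinuousOn (fun y => (y - z) ^ 3) (Ioc z v))) hl2
  refine ⟨3 * max D₁ D₂, fun lam ρ hlam hρ hv => ?_⟩
  have hsub : Icc (z + ρ) v ⊆ Ioc z v := fun y hy => ⟨by linarith [hy.1], hy.2⟩
  have hr : ‖Complex.I * (lam : ℂ)‖ = lam := by simp [abs_of_pos hlam]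
  have key := norm_integral_le_of_cubic (φ := fun y => φ y - φ z) (φ₁ := φ₁) (w := w) (w₁ := w₁)
    (z := z) (p := z + ρ) (q := v) (D := max D₁ D₂) (r := Complex.I * lam)
    (norm_pos_iff.1 (by rwa [hr])) (by linarith) hv
    (fun y _ => (h.hasDerivAt y).sub_const _) hφ₁c.continuousOn
    (fun y hy => (ha y).div (h.hasDerivAt₁ y) (hne y (hsub hy))) (hw₁c.mono hsub)
    (fun y _ => by simp)
    (fun y hy => by
      have hpos : 0 < y - z := sub_pos.2 (hsub hy).1
      have h1 := hD₁ y (hsub hy)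
      rw [Pi.mul_apply, abs_mul, abs_of_pos (a := (y - z) ^ 2) (by positivity)] at h1
      rw [le_div_iff₀ (by positivity)]
      exact h1.trans (le_max_left _ _))
    (fun y hy => by
      have hpos : 0 < y - z := sub_pos.2 (hsub hy).1
      have h1 := hD₂ y (hsub hy)
      rw [Pi.mul_apply, abs_mul, abs_of_pos (a := (y - z) ^ 3) (by positivity)] at h1
      rw [le_div_iff₀ (by positivity)]
      exact h1.trans (le_max_right _ _))
  rw [hr, add_sub_cancel_left] at key
  refine le_trans (le_of_eq ?_) key
  congr 1
  refine intervalIntegral.integral_congr fun y hy => ?_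
  rw [uIcc_of_le hv] at hy
  simp only [hw, div_mul_cancel₀ _ (hne y (hsub hy))]

/-- Near a cubic critical point, at the scale `h = lam ^ (-1/3)`, the oscillatory integral
converges to the truncated model integral. -/
theorem tendsto_integral_rescaled (h : IsCubicPoint φ φ₁ φ₂ κ z) (ha : Continuous a) (R : ℝ)
    (hR : 0 ≤ R) :
    Tendsto (fun t : ℝ => (t⁻¹ : ℂ) * ∫ y in z..(z + R * t),
        (a y : ℂ) * Complex.exp (-(Complex.I * ((t ^ 3)⁻¹ : ℝ) * (φ y - φ z : ℝ))))
      (𝓝[>] 0)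
      (𝓝 (a z * ∫ s in (0 : ℝ)..R, Complex.exp (-(Complex.I * κ * (s ^ 3 : ℝ))))) := by
  have hφc : Continuous φ := continuous_iff_continuousAt.2 fun y => (h.hasDerivAt y).continuousAt
  rw [← intervalIntegral.integral_const_mul]
  obtain ⟨A, hA⟩ := (isCompact_Icc (a := z) (b := z + R)).exists_bound_of_continuousOn
    ha.continuousOn
  have hev : ∀ᶠ t : ℝ in 𝓝[>] 0, 0 < t ∧ t ≤ 1 :=
    (eventually_mem_nhdsWithin (a := (0 : ℝ)) (s := Ioi 0)).and
      (nhdsWithin_le_nhds (eventually_le_nhds zero_lt_one))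
  have hconv : Tendsto (fun t : ℝ => ∫ s in (0 : ℝ)..R, (a (t * s + z) : ℂ) *
      Complex.exp (-(Complex.I * ((t ^ 3)⁻¹ : ℝ) * (φ (t * s + z) - φ z : ℝ)))) (𝓝[>] 0)
      (𝓝 (∫ s in (0 : ℝ)..R, (a z : ℂ) * Complex.exp (-(Complex.I * κ * (s ^ 3 : ℝ))))) := by
    refine intervalIntegral.tendsto_integral_filter_of_dominated_convergence (fun _ => A) ?_ ?_ ?_ ?_
    · exact Eventually.of_forall fun t => Continuous.aestronglyMeasurable (by fun_prop)
    · filter_upwards [hev] with t ht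
      refine Eventually.of_forall fun s hs => ?_
      rw [uIoc_of_le hR] at hs
      have h1 := norm_exp_neg_mul_le_one (r := Complex.I * ((t ^ 3)⁻¹ : ℝ))
        (x := φ (t * s + z) - φ z) (by rw [Complex.re_mul_ofReal]; simp)
      rw [norm_mul, Complex.norm_real]
      refine (mul_le_of_le_one_right (norm_nonneg _) h1).trans (hA _ ⟨?_, ?_⟩)
      · nlinarith [hs.1]
      · nlinarith [hs.1, hs.2]
    · exact intervalIntegrable_const
    · refine Eventually.of_forall fun s hs => ?_
      rw [uIoc_of_le hR] at hs
      have ht0 : Tendsto (fun t : ℝ => t * s + z) (𝓝[>] 0) (𝓝 z) :=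
        (Continuous.tendsto' (by fun_prop) _ _ (by simp)).mono_left nhdsWithin_le_nhds
      have ht1 : Tendsto (fun t : ℝ => t * s + z) (𝓝[>] 0) (𝓝[≠] z) := by
        refine tendsto_nhdsWithin_iff.2 ⟨ht0, hev.mono fun t ht => ?_⟩
        simp [ht.1.ne', hs.1.ne']
      have h2 : Tendsto (fun t : ℝ => (t ^ 3)⁻¹ * (φ (t * s + z) - φ z)) (𝓝[>] 0)
          (𝓝 (κ * s ^ 3)) := by
        refine ((h.tendsto_div.comp ht1).mul_const (s ^ 3)).congr' (hev.mono fun t ht => ?_)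
        have := ht.1.ne'
        have := hs.1.ne'
        simp only [Function.comp_apply, add_sub_cancel_right]
        field_simp
      have h3 := ((Complex.continuous_ofReal.tendsto _).comp h2).const_mul Complex.I
      have h4 := (Complex.continuous_exp.tendsto _).comp h3.neg
      refine Tendsto.mul ((Complex.continuous_ofReal.tendsto _).comp
        ((ha.tendsto z).comp ht0)) ?_
      convert h4 using 1
      · ext t; simp [mul_assoc]
      · simp [mul_assoc]
  refine hconv.congr' (hev.mono fun t ht => ?_)
  have := intervalIntegral.integral_comp_mul_add (a := 0) (b := R)
    (fun y => (a y : ℂ) * Complex.exp (-(Complex.I * ((t ^ 3)⁻¹ : ℝ) * (φ y - φ z : ℝ))))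
    ht.1.ne' z
  rw [this, Complex.real_smul]
  simp only [mul_zero, zero_add, Complex.ofReal_inv]
  rw [add_comm z, mul_comm R]

/-- The contribution of the right half of a cubic critical point. -/
theorem tendsto_integral_right (h : IsCubicPoint φ φ₁ φ₂ κ z)
    (ha : ∀ y, HasDerivAt a (a₁ y) y) (ha₁ : Continuous a₁) (hzv : z < v)
    (hne : ∀ y ∈ Ioc z v, φ₁ y ≠ 0) :
    Tendsto (fun t : ℝ => (t⁻¹ : ℂ) * ∫ y in z..v,
        (a y : ℂ) * Complex.exp (-(Complex.I * ((t ^ 3)⁻¹ : ℝ) * (φ y - φ z : ℝ))))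
      (𝓝[>] 0) (𝓝 (a z * cubicFresnel κ)) := by
  have hφc : Continuous φ := continuous_iff_continuousAt.2 fun y => (h.hasDerivAt y).continuousAt
  have hac : Continuous a := continuous_iff_continuousAt.2 fun y => (ha y).continuousAt
  obtain ⟨D, hD⟩ := h.exists_norm_integral_le ha ha₁ hne
  rw [Metric.tendsto_nhds]
  intro ε hε
  -- choose `R` so large that the outer part and the truncation of the model integral are small
  have hlim : Tendsto (fun R : ℝ => (D + |a z| * (2 / κ)) / R ^ 2) atTop (𝓝 0) :=
    tendsto_const_nhds.div_atTop (tendsto_pow_atTop two_ne_zero)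
  obtain ⟨R, hRε, hR⟩ := ((hlim.eventually_lt_const (half_pos hε)).and
    (eventually_gt_atTop 0)).exists
  have hinner := Metric.tendsto_nhds.1 (h.tendsto_integral_rescaled hac R hR.le) _ (half_pos hε)
  have hsmall : ∀ᶠ t : ℝ in 𝓝[>] 0, R * t < v - z :=
    nhdsWithin_le_nhds ((Continuous.tendsto' (by fun_prop) _ _ (by simp :
      R * (0 : ℝ) = 0)).eventually_lt_const (sub_pos.2 hzv))
  filter_upwards [hinner, hsmall, self_mem_nhdsWithin] with t ht1 ht2 (ht3 : 0 < t)
  set E : ℝ → ℂ := fun y => (a y : ℂ) *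
    Complex.exp (-(Complex.I * ((t ^ 3)⁻¹ : ℝ) * (φ y - φ z : ℝ))) with hE
  have hEc : Continuous E := by fun_prop
  have houter : ‖(t⁻¹ : ℂ) * ∫ y in (z + R * t)..v, E y‖ ≤ D / R ^ 2 := by
    have := hD (t ^ 3)⁻¹ (R * t) (by positivity) (by positivity) (by linarith)
    rw [norm_mul, norm_inv, Complex.norm_real, Real.norm_of_nonneg ht3.le]
    calc t⁻¹ * ‖∫ y in (z + R * t)..v, E y‖ ≤ t⁻¹ * (D / ((t ^ 3)⁻¹ * (R * t) ^ 2)) := by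
          gcongr
      _ = D / R ^ 2 := by field_simp
  have hmodel := norm_integral_sub_cubicFresnel_le h.pos hR
  rw [← intervalIntegral.integral_add_adjacent_intervals (b := z + R * t)
    (hEc.intervalIntegrable _ _) (hEc.intervalIntegrable _ _), dist_eq_norm]
  set G := ∫ s in (0 : ℝ)..R, Complex.exp (-(Complex.I * κ * (s ^ 3 : ℝ)))
  rw [dist_eq_norm] at ht1
  have hm : ‖(a z : ℂ) * (G - cubicFresnel κ)‖ ≤ |a z| * (2 / (κ * R ^ 2)) := by
    rw [norm_mul, Complex.norm_real, Real.norm_eq_abs]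
    gcongr
  have hsum : D / R ^ 2 + |a z| * (2 / (κ * R ^ 2)) = (D + |a z| * (2 / κ)) / R ^ 2 := by
    rw [← div_div]; ring
  calc ‖(t⁻¹ : ℂ) * ((∫ y in z..(z + R * t), E y) + ∫ y in (z + R * t)..v, E y)
        - a z * cubicFresnel κ‖
      = ‖((t⁻¹ : ℂ) * (∫ y in z..(z + R * t), E y) - a z * G)
        + ((t⁻¹ : ℂ) * ∫ y in (z + R * t)..v, E y) + a z * (G - cubicFresnel κ)‖ := by
        congr 1; ring
    _ ≤ _ := norm_add₃_le
    _ < ε := by linarith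

theorem reflect (h : IsCubicPoint φ φ₁ φ₂ κ z) :
    IsCubicPoint (fun y => -φ (2 * z - y)) (fun y => φ₁ (2 * z - y))
      (fun y => -φ₂ (2 * z - y)) κ z := by
  have hz : 2 * z - z = z := by ring
  have hd : ∀ y, HasDerivAt (fun y => 2 * z - y) (-1) y := fun y => by
    simpa using (hasDerivAt_id' y).const_sub (2 * z)
  refine ⟨fun y => ?_, fun y => ?_, ?_, ?_, ?_, ?_, h.pos⟩
  · exact (((h.hasDerivAt (2 * z - y)).comp y (hd y)).fun_neg).congr_deriv (by ring)
  · exact ((h.hasDerivAt₁ (2 * z - y)).comp y (hd y)).congr_deriv (by ring)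
  · have := h.continuous₂
    fun_prop
  · have h2 : HasDerivAt φ₂ (6 * κ) (2 * z - z) := by rw [hz]; exact h.hasDerivAt₂
    exact ((h2.comp z (hd z)).fun_neg).congr_deriv (by ring)
  · simp only [hz, h.eq_zero₁]
  · simp only [hz, h.eq_zero₂, neg_zero]

/-- The contribution of the left half of a cubic critical point is obtained from the right
half by reflection, which conjugates the oscillating factor. -/
theorem tendsto_integral_left (h : IsCubicPoint φ φ₁ φ₂ κ z)
    (ha : ∀ y, HasDerivAt a (a₁ y) y) (ha₁ : Continuous a₁) (huz : u < z)
    (hne : ∀ y ∈ Ico u z, φ₁ y ≠ 0) :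
    Tendsto (fun t : ℝ => (t⁻¹ : ℂ) * ∫ y in u..z,
        (a y : ℂ) * Complex.exp (-(Complex.I * ((t ^ 3)⁻¹ : ℝ) * (φ y - φ z : ℝ))))
      (𝓝[>] 0) (𝓝 (a z * (starRingEnd ℂ) (cubicFresnel κ))) := by
  have hd : ∀ y, HasDerivAt (fun y => 2 * z - y) (-1) y := fun y => by
    simpa using (hasDerivAt_id' y).const_sub (2 * z)
  have key := h.reflect.tendsto_integral_right (a := fun y => a (2 * z - y))
    (a₁ := fun y => -a₁ (2 * z - y)) (v := 2 * z - u)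
    (fun y => ((ha (2 * z - y)).comp y (hd y)).congr_deriv (by ring)) (by fun_prop)
    (by linarith) (fun y hy => hne _ ⟨by linarith [hy.2], by linarith [hy.1]⟩)
  have key2 := (Complex.continuous_conj.tendsto _).comp key
  have hz : 2 * z - z = z := by ring
  simp only [map_mul, Complex.conj_ofReal, hz] at key2
  refine key2.congr fun t => ?_
  simp only [Function.comp_apply, map_mul, map_inv₀, Complex.conj_ofReal]
  rw [intervalIntegral.integral_of_le (by linarith), ← integral_conj,
    ← intervalIntegral.integral_of_le (by linarith)]
  have := intervalIntegral.integral_comp_sub_left (a := z) (b := 2 * z - u)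
    (fun y => (a y : ℂ) * Complex.exp (-(Complex.I * ((t ^ 3)⁻¹ : ℝ) * (φ y - φ z : ℝ)))) (2 * z)
  rw [sub_sub_cancel, hz] at this
  rw [← this]
  congr 1
  refine intervalIntegral.integral_congr fun y _ => ?_
  simp only [map_mul, Complex.conj_ofReal, ← Complex.exp_conj, map_neg, Complex.conj_I]
  congr 2
  push_cast
  ring

theorem tendsto_integral (h : IsCubicPoint φ φ₁ φ₂ κ z)
    (ha : ∀ y, HasDerivAt a (a₁ y) y) (ha₁ : Continuous a₁) (huz : u < z) (hzv : z < v)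
    (hne : ∀ y ∈ Icc u v, y ≠ z → φ₁ y ≠ 0) :
    Tendsto (fun t : ℝ => (t⁻¹ : ℂ) * ∫ y in u..v,
        (a y : ℂ) * Complex.exp (-(Complex.I * ((t ^ 3)⁻¹ : ℝ) * (φ y - φ z : ℝ))))
      (𝓝[>] 0) (𝓝 (a z * (2 * (cubicFresnel κ).re : ℝ))) := by
  have hφc : Continuous φ := continuous_iff_continuousAt.2 fun y => (h.hasDerivAt y).continuousAt
  have hac : Continuous a := continuous_iff_continuousAt.2 fun y => (ha y).continuousAt
  have h1 := h.tendsto_integral_left ha ha₁ huz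
    (fun y hy => hne y ⟨hy.1, hy.2.le.trans hzv.le⟩ hy.2.ne)
  have h2 := h.tendsto_integral_right ha ha₁ hzv
    (fun y hy => hne y ⟨huz.le.trans hy.1.le, hy.2⟩ hy.1.ne')
  have h3 := h1.add h2
  rw [← mul_add, add_comm ((starRingEnd ℂ) _), Complex.add_conj] at h3
  refine h3.congr fun t => ?_
  rw [← mul_add, intervalIntegral.integral_add_adjacent_intervals] <;>
    exact Continuous.intervalIntegrable (by fun_prop) _ _

end IsCubicPoint

/-! ### Stationary phase with finitely many cubic critical points -/

section StationaryPhase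

variable {φ φ₁ φ₂ a a₁ : ℝ → ℝ}

theorem isLittleO_integral_of_ne_zero (hφ : ∀ y, HasDerivAt φ (φ₁ y) y)
    (hφ₁ : ∀ y, HasDerivAt φ₁ (φ₂ y) y) (hφ₂ : Continuous φ₂)
    (ha : ∀ y, HasDerivAt a (a₁ y) y) (ha₁ : Continuous a₁) {p q : ℝ} (hpq : p ≤ q)
    (hne : ∀ y ∈ Icc p q, φ₁ y ≠ 0) :
    (fun t : ℝ => ∫ y in p..q, (a y : ℂ) * Complex.exp (-(Complex.I * ((t ^ 3)⁻¹ : ℝ) * φ y)))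
      =o[𝓝[>] 0] fun t : ℝ => t := by
  have hac : Continuous a := continuous_iff_continuousAt.2 fun y => (ha y).continuousAt
  have hφ₁c : Continuous φ₁ := continuous_iff_continuousAt.2 fun y => (hφ₁ y).continuousAt
  set w : ℝ → ℝ := fun y => a y / φ₁ y with hw
  set w₁ : ℝ → ℝ := fun y => (a₁ y * φ₁ y - a y * φ₂ y) / φ₁ y ^ 2 with hw₁
  have hw₁c : ContinuousOn w₁ (Icc p q) :=
    (Continuous.continuousOn (by fun_prop)).div (by fun_prop)
      fun y hy => pow_ne_zero 2 (hne y hy)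
  have hO : (fun t : ℝ => ∫ y in p..q,
      (a y : ℂ) * Complex.exp (-(Complex.I * ((t ^ 3)⁻¹ : ℝ) * φ y)))
      =O[𝓝[>] 0] fun t : ℝ => t ^ 3 := by
    refine IsBigO.of_bound (|w p| + |w q| + ∫ y in p..q, |w₁ y|) ?_
    filter_upwards [self_mem_nhdsWithin] with t (ht : 0 < t)
    have hr : ‖Complex.I * (((t ^ 3)⁻¹ : ℝ) : ℂ)‖ = (t ^ 3)⁻¹ := by
      rw [norm_mul, Complex.norm_I, one_mul, Complex.norm_real,
        Real.norm_of_nonneg (by positivity)]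
    have key := norm_integral_mul_deriv_mul_exp_le (φ := φ) (φ₁ := φ₁) (w := w) (w₁ := w₁)
      (p := p) (q := q) (r := Complex.I * ((t ^ 3)⁻¹ : ℝ))
      (norm_pos_iff.1 (by rw [hr]; positivity)) hpq (fun y _ => hφ y) hφ₁c.continuousOn
      (fun y hy => (ha y).div (hφ₁ y) (hne y hy)) hw₁c
      (fun y _ => by rw [Complex.re_mul_ofReal]; simp)
    rw [hr, inv_inv, mul_comm (t ^ 3)] at key
    rw [Real.norm_of_nonneg (by positivity : 0 ≤ t ^ 3)]
    refine le_trans (le_of_eq ?_) key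
    congr 1
    refine intervalIntegral.integral_congr fun y hy => ?_
    rw [uIcc_of_le hpq] at hy
    simp only [hw, div_mul_cancel₀ _ (hne y hy)]
  refine hO.trans_isLittleO ?_
  refine IsLittleO.mono ?_ nhdsWithin_le_nhds
  simpa using isLittleO_pow_pow (𝕜 := ℝ) (m := 1) (n := 3) (by norm_num)

theorem IsCubicPoint.isLittleO_integral {κ z u v : ℝ} (h : IsCubicPoint φ φ₁ φ₂ κ z)
    (ha : ∀ y, HasDerivAt a (a₁ y) y) (ha₁ : Continuous a₁) (huz : u < z) (hzv : z < v)
    (hne : ∀ y ∈ Icc u v, y ≠ z → φ₁ y ≠ 0) :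
    (fun t : ℝ => (∫ y in u..v, (a y : ℂ) *
        Complex.exp (-(Complex.I * ((t ^ 3)⁻¹ : ℝ) * φ y))) -
      t * (a z * (2 * (cubicFresnel κ).re : ℝ) *
        Complex.exp (-(Complex.I * ((t ^ 3)⁻¹ : ℝ) * φ z))))
      =o[𝓝[>] 0] fun t : ℝ => t := by
  have h1 := h.tendsto_integral ha ha₁ huz hzv hne
  rw [isLittleO_iff]
  intro ε hε
  filter_upwards [Metric.tendsto_nhds.1 h1 ε hε, self_mem_nhdsWithin] with t ht (ht0 : 0 < t)
  have htne : (t : ℂ) ≠ 0 := by exact_mod_cast ht0.ne'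
  set r : ℂ := Complex.I * ((t ^ 3)⁻¹ : ℝ) with hr
  have hexp : ∀ y, Complex.exp (-(r * φ y)) =
      Complex.exp (-(r * φ z)) * Complex.exp (-(r * (φ y - φ z : ℝ))) := fun y => by
    rw [← Complex.exp_add]; congr 1; push_cast; ring
  have hint : ∫ y in u..v, (a y : ℂ) * Complex.exp (-(r * φ y)) =
      Complex.exp (-(r * φ z)) * ∫ y in u..v, (a y : ℂ) *
        Complex.exp (-(r * (φ y - φ z : ℝ))) := by
    rw [← intervalIntegral.integral_const_mul]
    refine intervalIntegral.integral_congr fun y _ => ?_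
    simp only [hexp y]; ring
  set J := ∫ y in u..v, (a y : ℂ) * Complex.exp (-(r * (φ y - φ z : ℝ)))
  have hle : ‖Complex.exp (-(r * φ z))‖ ≤ 1 :=
    norm_exp_neg_mul_le_one (by rw [hr, Complex.re_mul_ofReal]; simp)
  rw [dist_eq_norm] at ht
  have heq : Complex.exp (-(r * φ z)) * J - t * (a z * (2 * (cubicFresnel κ).re : ℝ) *
        Complex.exp (-(r * φ z))) =
      t * (Complex.exp (-(r * φ z)) *
        ((t : ℂ)⁻¹ * J - a z * (2 * (cubicFresnel κ).re : ℝ))) := by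
    field_simp
  rw [hint, heq, norm_mul, norm_mul, Complex.norm_real, mul_comm]
  gcongr
  calc _ ≤ 1 * ε := by gcongr
    _ = ε := one_mul _

/-- Stationary phase with finitely many cubic critical points, all interior. The parameter
`t` stands for `lam ^ (-1/3)`, where `lam` is the frequency. -/
theorem isLittleO_integral_sub_sum {κ : ℝ → ℝ} (hφ : ∀ y, HasDerivAt φ (φ₁ y) y)
    (hφ₁ : ∀ y, HasDerivAt φ₁ (φ₂ y) y) (hφ₂ : Continuous φ₂)
    (ha : ∀ y, HasDerivAt a (a₁ y) y) (ha₁ : Continuous a₁) {p : ℝ} (S : Finset ℝ) :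
    ∀ q, p ≤ q → (∀ z ∈ S, IsCubicPoint φ φ₁ φ₂ (κ z) z) → (∀ z ∈ S, z ∈ Ioo p q) →
    (∀ y ∈ Icc p q, y ∉ S → φ₁ y ≠ 0) →
    (fun t : ℝ => (∫ y in p..q, (a y : ℂ) *
        Complex.exp (-(Complex.I * ((t ^ 3)⁻¹ : ℝ) * φ y))) -
      t * ∑ z ∈ S, (a z * (2 * (cubicFresnel (κ z)).re : ℝ) *
        Complex.exp (-(Complex.I * ((t ^ 3)⁻¹ : ℝ) * φ z))))
      =o[𝓝[>] 0] fun t : ℝ => t := by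
  have hφc : Continuous φ := continuous_iff_continuousAt.2 fun y => (hφ y).continuousAt
  have hac : Continuous a := continuous_iff_continuousAt.2 fun y => (ha y).continuousAt
  induction S using Finset.induction_on_max with
  | empty =>
    intro q hpq _ _ hne
    simpa using isLittleO_integral_of_ne_zero hφ hφ₁ hφ₂ ha ha₁ hpq
      (fun y hy => hne y hy (by simp))
  | insert z S hmax ih =>
    intro q hpq hcub hmem hne
    have hzmem := hmem z (Finset.mem_insert_self _ _)
    -- cut the interval between `z` and the other critical points
    obtain ⟨m, ⟨hmz, hpm⟩, hSm⟩ : ∃ m, (m < z ∧ p < m) ∧ ∀ x ∈ S, x < m := by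
      have h1 : ∀ᶠ m in 𝓝[<] z, ∀ x ∈ S, x < m := by
        rw [Filter.eventually_all_finset]
        exact fun x hx => nhdsWithin_le_nhds (lt_mem_nhds (hmax x hx))
      exact (((eventually_mem_nhdsWithin (a := z) (s := Iio z)).and
        (nhdsWithin_le_nhds (lt_mem_nhds hzmem.1))).and h1).exists
    have h1 := ih m hpm.le (fun x hx => hcub x (Finset.mem_insert_of_mem hx))
      (fun x hx => ⟨(hmem x (Finset.mem_insert_of_mem hx)).1, hSm x hx⟩)
      (fun y hy hyS => hne y ⟨hy.1, hy.2.trans (hmz.trans hzmem.2).le⟩ (by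
        rw [Finset.mem_insert, not_or]
        exact ⟨(hy.2.trans_lt hmz).ne, hyS⟩))
    have h2 := (hcub z (Finset.mem_insert_self _ _)).isLittleO_integral ha ha₁ hmz hzmem.2
      (fun y hy hyz => hne y ⟨hpm.le.trans hy.1, hy.2⟩ (by
        rw [Finset.mem_insert, not_or]
        exact ⟨hyz, fun hyS => (hSm y hyS).not_ge hy.1⟩))
    refine (h1.add h2).congr_left fun t => ?_
    rw [Finset.sum_insert (fun hz => lt_irrefl z (hmax z hz)),
      ← intervalIntegral.integral_add_adjacent_intervals (a := p) (b := m) (c := q)]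
    · ring
    all_goals exact Continuous.intervalIntegrable (by fun_prop) _ _

end StationaryPhase

/-- The value of the two-sided cubic Fresnel integral, in the normalization of the Fourier
spectrum; the reflection formula turns `Γ(1/3)` into `1 / Γ(2/3)`. -/
theorem two_mul_re_cubicFresnel {κ : ℝ} (hκ : 0 < κ) :
    2 * (cubicFresnel κ).re =
      2 * Real.pi / (3 * Real.Gamma (2 / 3)) * (κ ^ (1 / 3 : ℝ))⁻¹ := by
  have hG : Complex.Gamma (1 / 3) = (Real.Gamma (1 / 3) : ℝ) := by
    rw [← Complex.Gamma_ofReal]; norm_num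
  have h1 : (1 / (Complex.I * κ)) ^ (1 / 3 : ℂ) =
      ((κ ^ (1 / 3 : ℝ))⁻¹ : ℝ) * Complex.exp (-(Real.pi / 6 : ℝ) * Complex.I) := by
    have hk : (κ : ℂ) ≠ 0 := by exact_mod_cast hκ.ne'
    have hI : 1 / (Complex.I * κ) = ((κ⁻¹ : ℝ) : ℂ) * (-Complex.I) := by
      push_cast
      rw [one_div, mul_inv, Complex.inv_I]
      ring
    have hI0 : (-Complex.I) ≠ 0 := neg_ne_zero.2 Complex.I_ne_zero
    have hκ' : (((κ⁻¹ : ℝ) : ℂ)) ≠ 0 := by exact_mod_cast (inv_pos.2 hκ).ne'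
    rw [hI, Complex.cpow_def_of_ne_zero (mul_ne_zero hκ' hI0),
      Complex.log_ofReal_mul (inv_pos.2 hκ) hI0, Complex.log_neg_I, Real.log_inv,
      ← Real.rpow_neg hκ.le, Real.rpow_def_of_pos hκ, Complex.ofReal_exp, ← Complex.exp_add]
    congr 1
    push_cast
    ring
  have hrefl : Real.Gamma (1 / 3) * Real.Gamma (2 / 3) = 2 * Real.pi / √3 := by
    have := Real.Gamma_mul_Gamma_one_sub (1 / 3)
    rw [show (1 : ℝ) - 1 / 3 = 2 / 3 by norm_num, mul_one_div, Real.sin_pi_div_three] at this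
    rw [this]; field_simp
  have hG2 : 0 < Real.Gamma (2 / 3) := Real.Gamma_pos_of_pos (by norm_num)
  have hre : (cubicFresnel κ).re =
      1 / 3 * ((κ ^ (1 / 3 : ℝ))⁻¹ * (√3 / 2) * Real.Gamma (1 / 3)) := by
    rw [cubicFresnel, h1, hG]
    have : (Complex.exp (-(Real.pi / 6 : ℝ) * Complex.I)).re = √3 / 2 := by
      rw [← Complex.ofReal_neg, Complex.exp_ofReal_mul_I_re, Real.cos_neg, Real.cos_pi_div_six]
    rw [show (1 / 3 : ℂ) = ((1 / 3 : ℝ) : ℂ) by norm_num, Complex.re_ofReal_mul,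
      Complex.re_mul_ofReal, Complex.re_ofReal_mul, this]
  rw [hre]
  have hs : √3 * √3 = 3 := Real.mul_self_sqrt (by norm_num)
  have h3 : Real.Gamma (1 / 3) = 2 * Real.pi / √3 / Real.Gamma (2 / 3) := by
    rw [← hrefl]; field_simp
  rw [h3]
  field_simp

/-! ### Characteristics of the Burgers equation -/

/-- The position at time `τ` of the characteristic of `U_τ = f(U) U_x` that starts at `y`,
where `g = f ∘ U₀`. -/
def charLine (g : ℝ → ℝ) (τ y : ℝ) : ℝ := y - τ * g y

/-- The starting point of the characteristic through `(τ, x)`: the inverse function of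
`charLine g τ`, which is meaningful as long as the latter is bijective. -/
noncomputable def charFoot (g : ℝ → ℝ) (τ : ℝ) : ℝ → ℝ := Function.invFun (charLine g τ)

section Characteristics

variable {f U₀ g : ℝ → ℝ} {T τ : ℝ}

theorem periodic_deriv {g : ℝ → ℝ} {c : ℝ} (hp : Function.Periodic g c) :
    Function.Periodic (deriv g) c := fun x => by
  have h : (fun y => g (y + c)) = g := funext hp
  rw [← deriv_comp_add_const, h]

theorem fract_eq_of_periodic (hp : Function.Periodic g 1) (x : ℝ) : g (Int.fract x) = g x := by
  have := (hp.int_mul ⌊x⌋) (Int.fract x)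
  rw [mul_one, Int.fract_add_floor] at this
  exact this.symm

theorem exists_isMaxOn_of_periodic (hg : Continuous g) (hp : Function.Periodic g 1) :
    ∃ x, IsMaxOn g univ x := by
  obtain ⟨x, -, hx⟩ := isCompact_Icc.exists_isMaxOn (nonempty_Icc.2 zero_le_one) hg.continuousOn
  refine ⟨x, fun y _ => ?_⟩
  rw [mem_ofPred_eq, ← fract_eq_of_periodic hp y]
  exact hx ⟨Int.fract_nonneg y, (Int.fract_lt_one y).le⟩

theorem isMaxOn_fract_iff (hp : Function.Periodic g 1) (x : ℝ) :
    IsMaxOn g univ (Int.fract x) ↔ IsMaxOn g univ x := by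
  simp only [isMaxOn_iff, fract_eq_of_periodic hp]

theorem iSup_eq_of_isMaxOn {x : ℝ} (hx : IsMaxOn g univ x) : ⨆ y, g y = g x :=
  le_antisymm (ciSup_le fun y => hx (mem_univ y))
    (le_ciSup (f := g) ⟨g x, by rintro _ ⟨y, rfl⟩; exact hx (mem_univ y)⟩ x)

/-- With finitely many maximum points in a period, no interval consists of maximum points. -/
theorem exists_mem_Ioo_not_isMaxOn {S : Finset ℝ} (hp : Function.Periodic g 1)
    (hS : ∀ x, x ∈ S ↔ x ∈ Ico (0 : ℝ) 1 ∧ IsMaxOn g univ x) {α β : ℝ} (hαβ : α < β) :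
    ∃ y ∈ Ioo α β, ¬ IsMaxOn g univ y := by
  by_contra! hall
  -- the interval would be contained in a countable union of translates of `S`
  have hsub : Ioo α β ⊆ ⋃ n : ℤ, (fun x : ℝ => x + n) '' (S : Set ℝ) := by
    intro y hy
    refine mem_iUnion.2 ⟨⌊y⌋, Int.fract y, ?_, Int.fract_add_floor y⟩
    rw [Finset.mem_coe, hS]
    exact ⟨⟨Int.fract_nonneg y, Int.fract_lt_one y⟩, (isMaxOn_fract_iff hp y).2 (hall y hy)⟩
  have hcount : (⋃ n : ℤ, (fun x : ℝ => x + n) '' (S : Set ℝ)).Countable :=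
    countable_iUnion fun n => (S.countable_toSet).image _
  have h0 := (hcount.mono hsub).measure_zero volume
  rw [Real.volume_Ioo, ENNReal.ofReal_eq_zero] at h0
  linarith

theorem iSup_deriv_pos {S : Finset ℝ} (hg : ContDiff ℝ 1 g) (hp : Function.Periodic g 1)
    (hS : ∀ x, x ∈ S ↔ x ∈ Ico (0 : ℝ) 1 ∧ IsMaxOn (deriv g) univ x) :
    0 < ⨆ x, deriv g x := by
  obtain ⟨x₀, hx₀⟩ := exists_isMaxOn_of_periodic (hg.continuous_deriv le_rfl) (periodic_deriv hp)
  rw [iSup_eq_of_isMaxOn hx₀]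
  by_contra! hle
  have hanti : Antitone g := antitone_of_deriv_nonpos (hg.differentiable one_ne_zero)
    fun x => (hx₀ (mem_univ x)).trans hle
  have hconst : ∀ x, g x = g 0 := fun x => by
    have h1 := hanti (Int.fract_nonneg x)
    have h2 := hanti (Int.fract_lt_one x).le
    rw [fract_eq_of_periodic hp] at h1 h2
    have h3 : g 1 = g 0 := by simpa using hp 0
    exact le_antisymm h1 (h3 ▸ h2)
  have hd : ∀ x, deriv g x = 0 := fun x => by
    rw [show g = fun _ => g 0 from funext hconst, deriv_const]
  obtain ⟨y, -, hy⟩ := exists_mem_Ioo_not_isMaxOn (periodic_deriv hp) hS zero_lt_one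
  exact hy fun x _ => by simp [hd]

/-- Up to the time `T` the characteristics do not cross: `T g' ≤ 1`, with equality nowhere on
an interval. -/
structure NonCrossing (g : ℝ → ℝ) (T : ℝ) : Prop where
  contDiff : ContDiff ℝ 1 g
  periodic : Function.Periodic g 1
  pos : 0 < T
  mul_deriv_le : ∀ y, T * deriv g y ≤ 1
  exists_lt : ∀ α β : ℝ, α < β → ∃ y ∈ Ioo α β, T * deriv g y < 1

theorem hasDerivAt_charLine (hg : Differentiable ℝ g) (τ y : ℝ) :
    HasDerivAt (charLine g τ) (1 - τ * deriv g y) y :=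
  (hasDerivAt_id' y).sub ((hg y).hasDerivAt.const_mul τ)

theorem charLine_add_one (hp : Function.Periodic g 1) (τ y : ℝ) :
    charLine g τ (y + 1) = charLine g τ y + 1 := by
  rw [charLine, charLine, hp y]; ring

namespace NonCrossing

theorem differentiable (h : NonCrossing g T) : Differentiable ℝ g :=
  h.contDiff.differentiable one_ne_zero

theorem strictMono (h : NonCrossing g T) (hτ : τ ∈ Icc 0 T) : StrictMono (charLine g τ) := by
  have hd := hasDerivAt_charLine h.differentiable τ
  have hmono : Monotone (charLine g τ) := by
    refine monotone_of_deriv_nonneg (fun y => (hd y).differentiableAt) fun y => ?_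
    rw [(hd y).deriv]
    rcases le_or_gt (deriv g y) 0 with h0 | h0
    · nlinarith [hτ.1]
    · nlinarith [hτ.2, h.mul_deriv_le y]
  intro α β hαβ
  refine lt_of_le_of_ne (hmono hαβ.le) fun heq => ?_
  obtain ⟨y, hy, hlt⟩ := h.exists_lt α β hαβ
  have hconst : charLine g τ =ᶠ[𝓝 y] fun _ => charLine g τ α := by
    filter_upwards [Ioo_mem_nhds hy.1 hy.2] with x hx
    exact le_antisymm (heq ▸ hmono hx.2.le) (hmono hx.1.le)
  have h0 := hconst.deriv_eq
  rw [(hd y).deriv, deriv_const] at h0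
  have hpos : 0 < deriv g y := by
    by_contra! hle
    nlinarith [hτ.1]
  nlinarith [hτ.2]

theorem continuous_charLine (h : NonCrossing g T) :
    Continuous (Function.uncurry (charLine g)) := by
  have := h.contDiff.continuous
  unfold Function.uncurry charLine
  fun_prop

theorem surjective (h : NonCrossing g T) (τ : ℝ) : Function.Surjective (charLine g τ) := by
  obtain ⟨G, hG⟩ := (isCompact_Icc (a := (0 : ℝ)) (b := 1)).exists_bound_of_continuousOn
    h.contDiff.continuous.continuousOn
  have hG' : ∀ y, |τ * g y| ≤ |τ| * G := fun y => by
    rw [abs_mul, ← fract_eq_of_periodic h.periodic y]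
    gcongr
    exact hG _ ⟨Int.fract_nonneg y, (Int.fract_lt_one y).le⟩
  have hc : Continuous (charLine g τ) := h.continuous_charLine.comp (Continuous.prodMk_right τ)
  refine hc.surjective ?_ ?_
  · refine tendsto_atTop_mono (f := fun y => y + -(|τ| * G)) (fun y => ?_)
      (tendsto_atTop_add_const_right _ _ tendsto_id)
    have := (abs_le.1 (hG' y)).2
    rw [charLine]; linarith
  · refine tendsto_atBot_mono (f := fun y => y + |τ| * G) (fun y => ?_)
      (tendsto_atBot_add_const_right _ _ tendsto_id)
    have := (abs_le.1 (hG' y)).1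
    rw [charLine]; linarith

theorem charLine_charFoot (h : NonCrossing g T) (τ x : ℝ) :
    charLine g τ (charFoot g τ x) = x :=
  Function.rightInverse_invFun (h.surjective τ) x

theorem charFoot_charLine (h : NonCrossing g T) (hτ : τ ∈ Icc 0 T) (y : ℝ) :
    charFoot g τ (charLine g τ y) = y :=
  Function.leftInverse_invFun (h.strictMono hτ).injective y

theorem continuousOn_charFoot (h : NonCrossing g T) :
    ContinuousOn (Function.uncurry (charFoot g)) (Icc 0 T ×ˢ univ) := by
  rintro ⟨τ, x⟩ ⟨hτ, -⟩
  have hτ : τ ∈ Icc 0 T := hτ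
  have hcont : ∀ b, Continuous fun q : ℝ × ℝ => charLine g q.1 b := fun b =>
    h.continuous_charLine.comp (by fun_prop : Continuous fun q : ℝ × ℝ => (q.1, b))
  refine tendsto_order.2 ⟨fun b hb => ?_, fun b hb => ?_⟩
  · have h1 : charLine g τ b < x := by
      rw [← h.charLine_charFoot τ x]; exact h.strictMono hτ hb
    have h2 : ∀ᶠ q : ℝ × ℝ in 𝓝 (τ, x), charLine g q.1 b < q.2 :=
      (hcont b).continuousAt.eventually_lt continuousAt_snd h1
    filter_upwards [nhdsWithin_le_nhds h2, self_mem_nhdsWithin] with q hq hqm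
    rw [← h.charLine_charFoot q.1 q.2] at hq
    exact (h.strictMono hqm.1).lt_iff_lt.1 hq
  · have h1 : x < charLine g τ b := by
      rw [← h.charLine_charFoot τ x]; exact h.strictMono hτ hb
    have h2 : ∀ᶠ q : ℝ × ℝ in 𝓝 (τ, x), q.2 < charLine g q.1 b :=
      continuousAt_snd.eventually_lt (hcont b).continuousAt h1
    filter_upwards [nhdsWithin_le_nhds h2, self_mem_nhdsWithin] with q hq hqm
    rw [← h.charLine_charFoot q.1 q.2] at hq
    exact (h.strictMono hqm.1).lt_iff_lt.1 hq

theorem charFoot_add_one (h : NonCrossing g T) (hτ : τ ∈ Icc 0 T) (x : ℝ) :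
    charFoot g τ (x + 1) = charFoot g τ x + 1 := by
  apply (h.strictMono hτ).injective
  rw [charLine_add_one h.periodic, h.charLine_charFoot, h.charLine_charFoot]

/-- The map `(τ, y) ↦ (τ, x)` from starting points to positions of characteristics, as a
homeomorphism of the strip `0 < τ < T`. -/
noncomputable def charHomeomorph (h : NonCrossing g T) :
    OpenPartialHomeomorph (ℝ × ℝ) (ℝ × ℝ) where
  toFun q := (q.1, charLine g q.1 q.2)
  invFun q := (q.1, charFoot g q.1 q.2)
  source := Ioo 0 T ×ˢ univ
  target := Ioo 0 T ×ˢ univ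
  map_source' _ hq := ⟨hq.1, mem_univ _⟩
  map_target' _ hq := ⟨hq.1, mem_univ _⟩
  left_inv' q hq := Prod.ext rfl (h.charFoot_charLine (Ioo_subset_Icc_self hq.1) q.2)
  right_inv' q _ := Prod.ext rfl (h.charLine_charFoot q.1 q.2)
  open_source := isOpen_Ioo.prod isOpen_univ
  open_target := isOpen_Ioo.prod isOpen_univ
  continuousOn_toFun := (continuous_fst.prodMk h.continuous_charLine).continuousOn
  continuousOn_invFun := continuousOn_fst.prodMk
    (h.continuousOn_charFoot.mono (prod_mono Ioo_subset_Icc_self Subset.rfl))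

theorem contDiffAt_charFoot (h : NonCrossing g T) {q : ℝ × ℝ} (hq : q ∈ Ioo 0 T ×ˢ univ) :
    ContDiffAt ℝ 1 (Function.uncurry (charFoot g)) q := by
  set y := charFoot g q.1 q.2 with hy
  have hd : 1 - q.1 * deriv g y ≠ 0 := by
    have h1 : 0 < q.1 ∧ q.1 < T := hq.1
    have h2 := h.mul_deriv_le y
    have : 0 < 1 - q.1 * deriv g y := by
      rcases le_or_gt (deriv g y) 0 with h0 | h0
      · nlinarith
      · nlinarith
    exact this.ne'
  have hfst : HasFDerivAt (fun p : ℝ × ℝ => p.1) (ContinuousLinearMap.fst ℝ ℝ ℝ) (q.1, y) :=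
    hasFDerivAt_fst
  have hsnd : HasFDerivAt (fun p : ℝ × ℝ => p.2) (ContinuousLinearMap.snd ℝ ℝ ℝ) (q.1, y) :=
    hasFDerivAt_snd
  have hgy : HasDerivAt g (deriv g y) ((q.1, y) : ℝ × ℝ).2 := (h.differentiable y).hasDerivAt
  have hfd := hfst.prodMk (hsnd.sub (hfst.mul (hgy.comp_hasFDerivAt (q.1, y) hsnd)))
  let e : (ℝ × ℝ) ≃L[ℝ] (ℝ × ℝ) := (ContinuousLinearEquiv.refl ℝ ℝ).skewProd
    (ContinuousLinearEquiv.unitsEquivAut ℝ (Units.mk0 _ hd))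
    (ContinuousLinearMap.toSpanSingleton ℝ (-g y))
  have hfd' : HasFDerivAt h.charHomeomorph (e : (ℝ × ℝ) →L[ℝ] (ℝ × ℝ))
      (h.charHomeomorph.symm q) := by
    refine hfd.congr_fderiv ?_
    ext <;> simp [e]
  have hgc := h.contDiff
  have hcd : ContDiffAt ℝ 1 h.charHomeomorph (h.charHomeomorph.symm q) := by
    change ContDiffAt ℝ 1 (fun p : ℝ × ℝ => (p.1, p.2 - p.1 * g p.2)) _
    fun_prop
  exact contDiffAt_snd.comp q (h.charHomeomorph.contDiffAt_symm hq hfd' hcd)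

end NonCrossing

/-- Existence: transport the initial datum along the characteristics. -/
theorem isBurgersSolution_charFoot (h : NonCrossing (fun y => f (U₀ y)) T)
    (hU₀ : ContDiff ℝ 1 U₀) (hp : Function.Periodic U₀ 1) :
    IsBurgersSolution f U₀ T
      (fun τ x => U₀ (charFoot (fun y => f (U₀ y)) τ x)) := by
  set g : ℝ → ℝ := fun y => f (U₀ y) with hg
  have hcd : ContDiffOn ℝ 1 (Function.uncurry fun τ x => U₀ (charFoot g τ x))
      (Ioo 0 T ×ˢ univ) := fun q hq =>
    (hU₀.contDiffAt.comp q (h.contDiffAt_charFoot hq)).contDiffWithinAt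
  refine ⟨fun τ hτ x => ?_, ?_, hcd, fun x => ?_, fun τ hτ x => ?_⟩
  · simp only [h.charFoot_add_one hτ, hp _]
  · exact hU₀.continuous.comp_continuousOn h.continuousOn_charFoot
  · have h0 : charFoot g 0 x = x := by
      simpa [charLine] using h.charLine_charFoot 0 x
    simp only [h0]
  · -- differentiate the identity `U τ (charLine g τ y) = U₀ y` in `τ`
    set V : ℝ × ℝ → ℝ := Function.uncurry fun τ x => U₀ (charFoot g τ x) with hV
    set y := charFoot g τ x with hy
    have hx : charLine g τ y = x := h.charLine_charFoot τ x
    have hmem : (τ, x) ∈ Ioo 0 T ×ˢ (univ : Set ℝ) := ⟨hτ, mem_univ _⟩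
    have hdiff : DifferentiableAt ℝ V (τ, x) :=
      (hcd.contDiffAt ((isOpen_Ioo.prod isOpen_univ).mem_nhds hmem)).differentiableAt one_ne_zero
    set D := fderiv ℝ V (τ, x) with hD
    have h1 : HasDerivAt (fun t => V (t, x)) (D (1, 0)) τ :=
      hdiff.hasFDerivAt.comp_hasDerivAt (f := fun t => (t, x)) τ ((hasDerivAt_id' τ).prodMk (hasDerivAt_const τ x))
    have h2 : HasDerivAt (fun s => V (τ, s)) (D (0, 1)) x :=
      hdiff.hasFDerivAt.comp_hasDerivAt x ((hasDerivAt_const x τ).prodMk (hasDerivAt_id' x))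
    have hl : HasDerivAt (fun t => charLine g t y) (-g y) τ := by
      simpa [charLine] using ((hasDerivAt_id' τ).mul_const (g y)).const_sub y
    have h3 : HasDerivAt (fun t => V (t, charLine g t y)) (D (1, -g y)) τ := by
      refine HasFDerivAt.comp_hasDerivAt (f := fun t => (t, charLine g t y)) (l := V) τ ?_
        ((hasDerivAt_id' τ).prodMk hl)
      rw [hx]; exact hdiff.hasFDerivAt
    have h4 : (fun t => V (t, charLine g t y)) =ᶠ[𝓝 τ] fun _ => U₀ y := by
      filter_upwards [Ioo_mem_nhds hτ.1 hτ.2] with t ht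
      change U₀ (charFoot g t (charLine g t y)) = U₀ y
      rw [h.charFoot_charLine (Ioo_subset_Icc_self ht)]
    have h5 : D (1, -g y) = 0 := by
      rw [← h3.deriv, h4.deriv_eq, deriv_const]
    have h6 : D (1, -g y) = D (1, 0) + (-g y) * D (0, 1) := by
      rw [← smul_eq_mul, ← map_smul, ← map_add]
      simp
    change deriv (fun t => V (t, x)) τ = g y * deriv (fun s => V (τ, s)) x
    rw [h1.deriv, h2.deriv]
    linarith

/-- A classical solution is constant along straight lines of slope `-f(U)`: along such a line
it solves a scalar ordinary differential equation of which the constant is a solution. -/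
theorem IsBurgersSolution.eq_along_line {U : ℝ → ℝ → ℝ} (h : IsBurgersSolution f U₀ T U)
    (hf : ContDiff ℝ 1 f) {τ₀ : ℝ} (hτ₀ : τ₀ ∈ Ioo 0 T) (x₀ : ℝ) (hτ : τ ∈ Ioo 0 T) :
    U τ (x₀ - (τ - τ₀) * f (U τ₀ x₀)) = U τ₀ x₀ := by
  set v := f (U τ₀ x₀) with hv
  set γ : ℝ → ℝ × ℝ := fun t => (t, x₀ - (t - τ₀) * v) with hγ
  have hγc : Continuous γ := by fun_prop
  have hopen : IsOpen (Ioo 0 T ×ˢ (univ : Set ℝ)) := isOpen_Ioo.prod isOpen_univ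
  set V := Function.uncurry U with hV
  have hγm : ∀ t ∈ Ioo 0 T, γ t ∈ Ioo 0 T ×ˢ (univ : Set ℝ) := fun t ht => ⟨ht, mem_univ _⟩
  have hdiff : ∀ t ∈ Ioo 0 T, DifferentiableAt ℝ V (γ t) := fun t ht =>
    (h.contDiffOn.contDiffAt (hopen.mem_nhds (hγm t ht))).differentiableAt one_ne_zero
  set p : ℝ → ℝ := fun t => fderiv ℝ V (γ t) (0, 1) with hp
  have hpc : ContinuousOn p (Ioo 0 T) :=
    ((h.contDiffOn.continuousOn_fderiv_of_isOpen hopen le_rfl).comp hγc.continuousOn hγm).clm_apply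
      continuousOn_const
  have hWd : ∀ t ∈ Ioo 0 T, HasDerivAt (fun t => V (γ t)) ((f (V (γ t)) - v) * p t) t := by
    intro t ht
    set D := fderiv ℝ V (γ t) with hD
    set x := x₀ - (t - τ₀) * v with hx
    have hd : HasFDerivAt V D (t, x) := (hdiff t ht).hasFDerivAt
    have h1 : HasDerivAt (fun t => V (t, x)) (D (1, 0)) t :=
      hd.comp_hasDerivAt (f := fun t => (t, x)) t ((hasDerivAt_id' t).prodMk (hasDerivAt_const t x))
    have h2 : HasDerivAt (fun s => V (t, s)) (D (0, 1)) x :=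
      hd.comp_hasDerivAt x ((hasDerivAt_const x t).prodMk (hasDerivAt_id' x))
    have heq : D (1, 0) = f (V (γ t)) * D (0, 1) := by
      rw [← h1.deriv, ← h2.deriv]; exact h.equation t ht x
    have hl : HasDerivAt (fun t => x₀ - (t - τ₀) * v) (-v) t := by
      simpa using (((hasDerivAt_id' t).sub_const τ₀).mul_const v).const_sub x₀
    have h3 : HasDerivAt (fun t => V (γ t)) (D (1, -v)) t :=
      (hdiff t ht).hasFDerivAt.comp_hasDerivAt t ((hasDerivAt_id' t).prodMk hl)
    have h6 : D (1, -v) = D (1, 0) + (-v) * D (0, 1) := by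
      rw [← smul_eq_mul, ← map_smul, ← map_add]
      simp
    refine h3.congr_deriv ?_
    rw [h6, heq]; ring
  have hWc : ContinuousOn (fun t => V (γ t)) (Ioo 0 T) := fun t ht =>
    (hWd t ht).continuousAt.continuousWithinAt
  -- a compact time interval inside `(0, T)` with both times in its interior
  obtain ⟨α, hα0, hα⟩ := exists_between (lt_min hτ₀.1 hτ.1)
  obtain ⟨β, hβ, hβT⟩ := exists_between (max_lt hτ₀.2 hτ.2)
  have hsub : Icc α β ⊆ Ioo 0 T := fun t ht => ⟨hα0.trans_le ht.1, ht.2.trans_lt hβT⟩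
  obtain ⟨P, hP⟩ := isCompact_Icc.exists_bound_of_continuousOn (hpc.mono hsub)
  obtain ⟨B, hB⟩ := isCompact_Icc.exists_bound_of_continuousOn (hWc.mono hsub)
  obtain ⟨L, hL⟩ := (hf.locallyLipschitz.locallyLipschitzOn
    (s := Metric.closedBall (0 : ℝ) B)).exists_lipschitzOnWith_of_compact
    (isCompact_closedBall 0 B)
  have hτ₀' : τ₀ ∈ Ioo α β := ⟨hα.trans_le (min_le_left _ _), (le_max_left _ _).trans_lt hβ⟩
  have hτ' : τ ∈ Ioo α β := ⟨hα.trans_le (min_le_right _ _), (le_max_right _ _).trans_lt hβ⟩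
  have hball : ∀ t ∈ Ioo α β, V (γ t) ∈ Metric.closedBall (0 : ℝ) B := fun t ht => by
    rw [mem_closedBall_zero_iff]; exact hB t (Ioo_subset_Icc_self ht)
  have hW₀ : V (γ τ₀) = U τ₀ x₀ := by simp [hV, hγ]
  have key := ODE_solution_unique_of_mem_Ioo (v := fun t w => (f w - v) * p t)
    (s := fun _ => Metric.closedBall (0 : ℝ) B) (K := L * P.toNNReal) (a := α) (b := β)
    (t₀ := τ₀) (f := fun t => V (γ t)) (g := fun _ => U τ₀ x₀)
    (fun t ht => by
      refine LipschitzOnWith.of_dist_le_mul fun w₁ hw₁ w₂ hw₂ => ?_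
      have h1 := hL.dist_le_mul w₁ hw₁ w₂ hw₂
      have h2 := hP t (Ioo_subset_Icc_self ht)
      rw [Real.dist_eq, ← sub_mul, abs_mul, sub_sub_sub_cancel_right]
      rw [Real.dist_eq] at h1
      push_cast
      rw [mul_right_comm]
      gcongr
      exact h2.trans (Real.le_coe_toNNReal P))
    hτ₀'
    (fun t ht => ⟨hWd t (hsub (Ioo_subset_Icc_self ht)), hball t ht⟩)
    (fun t ht => ⟨by
      simpa [← hv] using hasDerivAt_const t (U τ₀ x₀), hW₀ ▸ hball τ₀ hτ₀'⟩)
    hW₀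
  exact key hτ'

/-- Uniqueness: at the final time every solution is the initial datum transported along the
characteristics. -/
theorem IsBurgersSolution.apply_charLine {U : ℝ → ℝ → ℝ} (h : IsBurgersSolution f U₀ T U)
    (hf : ContDiff ℝ 1 f) (hg : NonCrossing (fun y => f (U₀ y)) T) (y : ℝ) :
    U T (charLine (fun y => f (U₀ y)) T y) = U₀ y := by
  set g : ℝ → ℝ := fun y => f (U₀ y) with hgdef
  have hT := hg.pos
  -- constancy along a line extends by continuity to the closed time interval
  have hlim : ∀ t₁ ∈ Icc 0 T, ∀ x v c : ℝ, (∀ t ∈ Ioo 0 T, U t (x - t * v) = c) →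
      U t₁ (x - t₁ * v) = c := by
    intro t₁ ht₁ x v c hc
    have hcont : ContinuousOn (fun t => U t (x - t * v)) (Icc 0 T) :=
      h.continuousOn.comp (f := fun t => (t, x - t * v)) (by fun_prop)
        fun t ht => ⟨ht, mem_univ _⟩
    have heq : EqOn (fun t => U t (x - t * v)) (fun _ => c) (closure (Ioo 0 T)) := by
      refine EqOn.of_subset_closure (s := Ioo 0 T) (t := closure (Ioo 0 T)) hc ?_
        continuousOn_const subset_closure Subset.rfl
      rwa [closure_Ioo hT.ne]
    exact heq (by rwa [closure_Ioo hT.ne])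
  refine hlim T ⟨hT.le, le_rfl⟩ y (g y) _ fun τ hτ => ?_
  set x := y - τ * g y with hx
  set c := U τ x with hc
  have hline : ∀ t ∈ Ioo 0 T, U t (x + τ * f c - t * f c) = c := fun t ht => by
    refine Eq.trans ?_ (h.eq_along_line hf hτ x ht)
    congr 1
    ring
  -- trace the line through `(τ, x)` back to time zero, where it must start at `y`
  have h0 := hlim 0 ⟨le_rfl, hT.le⟩ _ _ _ hline
  rw [zero_mul, sub_zero, h.initial] at h0
  have hfoot : x + τ * f c = y := by
    apply (hg.strictMono (Ioo_subset_Icc_self hτ)).injective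
    change x + τ * f c - τ * f (U₀ (x + τ * f c)) = x
    rw [h0]; ring
  rw [← h0, hfoot]

end Characteristics

/-! ### Lower bounds for exponential sums -/

section ExponentialSums

/-- Among `#S` consecutive values of an exponential sum with `#S` distinct frequencies and
nonzero coefficients one is bounded below: a combination of these values, with the
coefficients of a Lagrange basis polynomial, isolates a single frequency. -/
theorem exists_le_norm_sum_mul_pow {ι : Type*} [DecidableEq ι] {S : Finset ι} (hS : S.Nonempty)
    {b v : ι → ℂ} (hv : Set.InjOn v S) (hv1 : ∀ z ∈ S, ‖v z‖ = 1) (hb : ∀ z ∈ S, b z ≠ 0) :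
    ∃ c > 0, ∀ k : ℕ, ∃ i < S.card, c ≤ ‖∑ z ∈ S, b z * v z ^ (k + i)‖ := by
  obtain ⟨z₀, hz₀⟩ := hS
  set P := Lagrange.basis S v z₀ with hP
  have hdeg : P.natDegree < S.card := by
    have h1 : P.natDegree = S.card - 1 := by
      rw [Polynomial.natDegree_eq_of_degree_eq_some (Lagrange.degree_basis hv hz₀)]
    have := Finset.card_pos.2 ⟨z₀, hz₀⟩
    omega
  set C := ∑ i ∈ Finset.range S.card, ‖P.coeff i‖ with hC
  have hC0 : 0 ≤ C := Finset.sum_nonneg fun _ _ => norm_nonneg _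
  have hb0 : 0 < ‖b z₀‖ := norm_pos_iff.2 (hb z₀ hz₀)
  refine ⟨‖b z₀‖ / (C + 1), by positivity, fun k => ?_⟩
  by_contra! hlt
  have hiso : ∑ i ∈ Finset.range S.card, P.coeff i * ∑ z ∈ S, b z * v z ^ (k + i) =
      b z₀ * v z₀ ^ k := by
    calc ∑ i ∈ Finset.range S.card, P.coeff i * ∑ z ∈ S, b z * v z ^ (k + i)
        = ∑ z ∈ S, b z * v z ^ k * P.eval (v z) := by
          simp_rw [Finset.mul_sum]
          rw [Finset.sum_comm]
          refine Finset.sum_congr rfl fun z _ => ?_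
          rw [Polynomial.eval_eq_sum_range' hdeg, Finset.mul_sum]
          exact Finset.sum_congr rfl fun i _ => by ring
      _ = b z₀ * v z₀ ^ k := by
          rw [Finset.sum_eq_single_of_mem z₀ hz₀ fun z hz hne => by
            rw [hP, Lagrange.eval_basis_of_ne hne.symm hz, mul_zero],
            hP, Lagrange.eval_basis_self hv hz₀, mul_one]
  have hle : ‖b z₀‖ ≤ C * (‖b z₀‖ / (C + 1)) := by
    calc ‖b z₀‖ = ‖b z₀ * v z₀ ^ k‖ := by rw [norm_mul, norm_pow, hv1 z₀ hz₀, one_pow, mul_one]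
      _ ≤ ∑ i ∈ Finset.range S.card, ‖P.coeff i * ∑ z ∈ S, b z * v z ^ (k + i)‖ := by
          rw [← hiso]; exact norm_sum_le _ _
      _ ≤ ∑ i ∈ Finset.range S.card, ‖P.coeff i‖ * (‖b z₀‖ / (C + 1)) := by
          refine Finset.sum_le_sum fun i hi => ?_
          rw [norm_mul]
          gcongr
          exact (hlt i (Finset.mem_range.1 hi)).le
      _ = C * (‖b z₀‖ / (C + 1)) := by rw [hC, Finset.sum_mul]
  rw [mul_div_assoc', le_div_iff₀ (by positivity)] at hle
  nlinarith

end ExponentialSums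

/-! ### From the Fourier coefficients to the spectrum -/

section Spectrum

variable {F A : ℕ → ℂ}

theorem isLittleO_normSq_sub (hF : (fun k : ℕ => F k -
      (-Complex.I * A k * (((k : ℝ) ^ (-(4 / 3) : ℝ) : ℝ) : ℂ)))
        =o[atTop] fun k : ℕ => (k : ℝ) ^ (-(4 / 3) : ℝ))
    {C : ℝ} (hA : ∀ k, ‖A k‖ ≤ C) :
    (fun k : ℕ => ‖F k‖ ^ 2 - ‖A k‖ ^ 2 * (k : ℝ) ^ (-(8 / 3) : ℝ))
        =o[atTop] fun k : ℕ => (k : ℝ) ^ (-(8 / 3) : ℝ) := by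
  set e : ℕ → ℝ := fun k => (k : ℝ) ^ (-(4 / 3) : ℝ) with he
  have he0 : ∀ k, 0 ≤ e k := fun k => by positivity
  have he2 : ∀ᶠ k : ℕ in atTop, (k : ℝ) ^ (-(8 / 3) : ℝ) = e k * e k := by
    filter_upwards [eventually_gt_atTop 0] with k hk
    rw [he, ← Real.rpow_add (by exact_mod_cast hk)]
    norm_num
  set G : ℕ → ℂ := fun k => -Complex.I * A k * ((e k : ℝ) : ℂ) with hG
  have hGn : ∀ k, ‖G k‖ = ‖A k‖ * e k := fun k => by
    rw [hG, norm_mul, norm_mul, norm_neg, Complex.norm_I, one_mul, Complex.norm_real,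
      Real.norm_of_nonneg (he0 k)]
  have hGO : G =O[atTop] e := by
    refine IsBigO.of_bound C (Eventually.of_forall fun k => ?_)
    rw [hGn, Real.norm_of_nonneg (he0 k)]
    exact mul_le_mul_of_nonneg_right (hA k) (he0 k)
  have hFO : F =O[atTop] e := (hF.isBigO.add hGO).congr_left fun k => sub_add_cancel _ _
  have h1 : (fun k => ‖F k‖ - ‖G k‖) =o[atTop] e := by
    refine IsBigO.trans_isLittleO (IsBigO.of_bound 1 (Eventually.of_forall fun k => ?_)) hF
    rw [one_mul]
    exact abs_norm_sub_norm_le _ _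
  have h2 : (fun k => ‖F k‖ + ‖G k‖) =O[atTop] e := hFO.norm_left.add hGO.norm_left
  refine (h1.mul_isBigO h2).congr' ?_ (he2.mono fun k hk => hk.symm)
  filter_upwards [he2] with k hk
  rw [hk, hGn]
  ring

theorem isEquivalent_normSq
    (hF : (fun k : ℕ => ‖F k‖ ^ 2 - ‖A k‖ ^ 2 * (k : ℝ) ^ (-(8 / 3) : ℝ))
        =o[atTop] fun k : ℕ => (k : ℝ) ^ (-(8 / 3) : ℝ)) {δ : ℝ} (hδ : 0 < δ) :
    (fun k : ℕ => ‖F k‖ ^ 2) ~[atTop ⊓ 𝓟 {k : ℕ | δ ≤ ‖A k‖}]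
      fun k : ℕ => ‖A k‖ ^ 2 * (k : ℝ) ^ (-(8 / 3) : ℝ) := by
  refine (hF.mono inf_le_left).trans_isBigO (IsBigO.of_bound (δ ^ 2)⁻¹ ?_)
  filter_upwards [mem_inf_of_right (mem_principal_self _)] with k (hk : δ ≤ ‖A k‖)
  rw [norm_mul, Real.norm_of_nonneg (sq_nonneg ‖A k‖), ← mul_assoc]
  refine le_mul_of_one_le_left (norm_nonneg _) ?_
  rw [inv_mul_eq_div, one_le_div (by positivity)]
  gcongr

theorem exists_bounds_normSq
    (hF : (fun k : ℕ => ‖F k‖ ^ 2 - ‖A k‖ ^ 2 * (k : ℝ) ^ (-(8 / 3) : ℝ))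
        =o[atTop] fun k : ℕ => (k : ℝ) ^ (-(8 / 3) : ℝ))
    {C c : ℝ} (hA : ∀ k, ‖A k‖ ≤ C) (hc : 0 < c) {m : ℕ}
    (hlow : ∀ k, ∃ i < m, c ≤ ‖A (k + i)‖) :
    ∃ a b : ℝ, 0 < a ∧ 0 < b ∧ ∀ᶠ k : ℕ in atTop,
      ‖F k‖ ^ 2 ≤ b * (k : ℝ) ^ (-(8 / 3) : ℝ) ∧
      ∃ i < m, a * ((k + i : ℕ) : ℝ) ^ (-(8 / 3) : ℝ) ≤ ‖F (k + i)‖ ^ 2 := by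
  have hc2 : 0 < c ^ 2 / 2 := by positivity
  refine ⟨c ^ 2 / 2, C ^ 2 + c ^ 2 / 2, hc2, by positivity, ?_⟩
  have hev : ∀ᶠ k : ℕ in atTop, |‖F k‖ ^ 2 - ‖A k‖ ^ 2 * (k : ℝ) ^ (-(8 / 3) : ℝ)| ≤
      c ^ 2 / 2 * (k : ℝ) ^ (-(8 / 3) : ℝ) := by
    filter_upwards [hF.def hc2] with k hk
    rwa [Real.norm_eq_abs, Real.norm_of_nonneg (by positivity)] at hk
  obtain ⟨N, hN⟩ := eventually_atTop.1 hev
  filter_upwards [eventually_ge_atTop N] with k hk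
  constructor
  · have h1 := (abs_le.1 (hN k hk)).2
    have h2 : ‖A k‖ ^ 2 * (k : ℝ) ^ (-(8 / 3) : ℝ) ≤ C ^ 2 * (k : ℝ) ^ (-(8 / 3) : ℝ) := by
      have := hA k
      gcongr
    linarith
  · obtain ⟨i, hi, hci⟩ := hlow k
    refine ⟨i, hi, ?_⟩
    have h1 := (abs_le.1 (hN (k + i) (by omega))).1
    have h2 : c ^ 2 * ((k + i : ℕ) : ℝ) ^ (-(8 / 3) : ℝ) ≤
        ‖A (k + i)‖ ^ 2 * ((k + i : ℕ) : ℝ) ^ (-(8 / 3) : ℝ) := by gcongr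
    linarith

end Spectrum

/-! ### Fourier coefficients of a transported profile -/

section FourierModes

theorem fourierMode_eq_integral (u : ℝ → ℝ) (k : ℕ) :
    fourierMode u k = ∫ x in (0 : ℝ)..1,
      (u x : ℂ) * Complex.exp (-(Complex.I * (2 * Real.pi * k : ℝ) * x)) := by
  rw [fourierMode, fourierCoeffOn_eq_integral]
  simp only [sub_zero, ne_eq, one_ne_zero, not_false_eq_true, div_self, one_smul]
  refine intervalIntegral.integral_congr fun x _ => ?_
  simp only [smul_eq_mul, fourier_coe_apply]
  rw [mul_comm]
  congr 2
  push_cast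
  ring

theorem exp_neg_I_mul_add_one (k : ℕ) (x : ℝ) :
    Complex.exp (-(Complex.I * (2 * Real.pi * k : ℝ) * (x + 1 : ℝ))) =
      Complex.exp (-(Complex.I * (2 * Real.pi * k : ℝ) * x)) := by
  have h : -(Complex.I * (2 * Real.pi * k : ℝ) * ((x + 1 : ℝ) : ℂ)) =
      -(Complex.I * (2 * Real.pi * k : ℝ) * x) - k * (2 * Real.pi * Complex.I) := by
    push_cast; ring
  rw [h, Complex.exp_sub, Complex.exp_nat_mul_two_pi_mul_I, div_one]

/-- If `u` is obtained from `U₀` by transport along `φ`, the substitution `x = φ y` and an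
integration by parts turn the Fourier coefficient into an oscillatory integral. -/
theorem fourierMode_eq_integral_deriv {u U₀ U₀' φ φ₁ : ℝ → ℝ} (hu : Continuous u)
    (hup : Function.Periodic u 1) (hφ : ∀ y, HasDerivAt φ (φ₁ y) y) (hφ₁ : Continuous φ₁)
    (hφ1 : ∀ y, φ (y + 1) = φ y + 1) (huφ : ∀ y, u (φ y) = U₀ y)
    (hU : ∀ y, HasDerivAt U₀ (U₀' y) y) (hU' : Continuous U₀') (hU₀ : U₀ 1 = U₀ 0)
    {k : ℕ} (hk : k ≠ 0) :
    fourierMode u k = (Complex.I * (2 * Real.pi * k : ℝ))⁻¹ * ∫ y in (0 : ℝ)..1,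
      (U₀' y : ℂ) * Complex.exp (-(Complex.I * (2 * Real.pi * k : ℝ) * φ y)) := by
  have hr : Complex.I * ((2 * Real.pi * k : ℝ) : ℂ) ≠ 0 := by
    refine mul_ne_zero Complex.I_ne_zero (Complex.ofReal_ne_zero.2 ?_)
    have : (0 : ℝ) < k := by exact_mod_cast Nat.pos_of_ne_zero hk
    positivity
  set r := Complex.I * ((2 * Real.pi * k : ℝ) : ℂ) with hrdef
  have hper : Function.Periodic (fun x : ℝ => (u x : ℂ) * Complex.exp (-(r * x))) 1 := fun x => by
    simp only [hup x]
    rw [hrdef, exp_neg_I_mul_add_one]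
  have h1 : φ 1 = φ 0 + 1 := by simpa using hφ1 0
  have hsub := intervalIntegral.integral_deriv_smul_comp (a := 0) (b := 1) (f := φ) (f' := φ₁)
    (g := fun x : ℝ => (u x : ℂ) * Complex.exp (-(r * x)))
    (fun y _ => hφ y) hφ₁.continuousOn (by fun_prop)
  have hshift := hper.intervalIntegral_add_eq 0 (φ 0)
  rw [zero_add] at hshift
  rw [fourierMode_eq_integral, hshift, ← h1, ← hsub]
  have hparts := integral_mul_deriv_mul_exp (φ := φ) (φ₁ := φ₁) (w := U₀) (w₁ := U₀')
    (p := 0) (q := 1) hr (fun y _ => hφ y) hφ₁.continuousOn (fun y _ => hU y) hU'.continuousOn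
  have hcongr : ∫ y in (0 : ℝ)..1, φ₁ y • ((fun x : ℝ => (u x : ℂ) * Complex.exp (-(r * x))) ∘ φ) y
      = ∫ y in (0 : ℝ)..1, ((U₀ y * φ₁ y : ℝ) : ℂ) * Complex.exp (-(r * φ y)) := by
    refine intervalIntegral.integral_congr fun y _ => ?_
    simp only [Function.comp_apply, huφ, Complex.real_smul]
    push_cast
    ring
  rw [hcongr, hparts, h1, hU₀, hrdef, exp_neg_I_mul_add_one]
  ring

end FourierModes

/-! ### Fourier coefficients at the shock time -/

section Assembly

variable {f U₀ g : ℝ → ℝ} {T : ℝ} {S : Finset ℝ}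

theorem contDiff_of_trigPolynomial {M : ℕ} {c : ℤ → ℂ} (hU₀ : ∀ x : ℝ, (U₀ x : ℂ) =
      ∑ n ∈ Finset.Icc (-(M : ℤ)) (M : ℤ), c n * Complex.exp (2 * Real.pi * Complex.I * n * x))
    (n : ℕ) : ContDiff ℝ n U₀ := by
  have h : U₀ = fun x : ℝ => (∑ n ∈ Finset.Icc (-(M : ℤ)) (M : ℤ),
      c n * Complex.exp (2 * Real.pi * Complex.I * n * x)).re := by
    ext x; rw [← hU₀, Complex.ofReal_re]
  rw [h]
  refine Complex.reCLM.contDiff.comp (ContDiff.sum fun n _ => ?_)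
  refine contDiff_const.mul (ContDiff.cexp (contDiff_const.mul Complex.ofRealCLM.contDiff))

theorem periodic_of_trigPolynomial {M : ℕ} {c : ℤ → ℂ} (hU₀ : ∀ x : ℝ, (U₀ x : ℂ) =
      ∑ n ∈ Finset.Icc (-(M : ℤ)) (M : ℤ), c n * Complex.exp (2 * Real.pi * Complex.I * n * x)) :
    Function.Periodic U₀ 1 := by
  intro x
  have h : (U₀ (x + 1) : ℂ) = U₀ x := by
    rw [hU₀, hU₀]
    refine Finset.sum_congr rfl fun n _ => ?_
    congr 1
    have : 2 * Real.pi * Complex.I * n * ((x + 1 : ℝ) : ℂ) =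
        2 * Real.pi * Complex.I * n * x + n * (2 * Real.pi * Complex.I) := by
      push_cast; ring
    rw [this, Complex.exp_add, Complex.exp_int_mul_two_pi_mul_I, mul_one]
  exact_mod_cast h

theorem iteratedDeriv_three (g : ℝ → ℝ) : iteratedDeriv 3 g = deriv (deriv (deriv g)) := by
  simp [iteratedDeriv_succ, iteratedDeriv_zero]

/-- At a maximum point of `g'` the second derivative of `g'` is nonpositive. -/
theorem iteratedDeriv_three_nonpos (hg : ContDiff ℝ 1 g) {z : ℝ}
    (hz : IsMaxOn (deriv g) univ z) : iteratedDeriv 3 g z ≤ 0 := by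
  rw [iteratedDeriv_three]
  by_contra! hpos
  have hmax : IsLocalMax (deriv g) z := Eventually.of_forall fun y => hz (mem_univ y)
  have hmin := isLocalMin_of_deriv_deriv_pos hpos hmax.deriv_eq_zero
    (hg.continuous_deriv le_rfl).continuousAt
  -- `z` would be a minimum and a maximum point, hence `g'` constant near `z`
  have hconst : deriv g =ᶠ[𝓝 z] fun _ => deriv g z := by
    filter_upwards [hmin] with y hy
    exact le_antisymm (hz (mem_univ y)) hy
  have h0 : deriv (deriv g) =ᶠ[𝓝 z] fun _ => 0 := by
    filter_upwards [hconst.eventuallyEq_nhds] with y hy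
    rw [hy.deriv_eq, deriv_const]
  rw [h0.deriv_eq, deriv_const] at hpos
  exact lt_irrefl _ hpos

/-- A maximum point of `g'` at which `T g' = 1` is a cubic critical point of the final
characteristic map. -/
theorem isCubicPoint_charLine (hg : ContDiff ℝ 3 g) (hT : 0 < T) {z : ℝ}
    (hz : IsMaxOn (deriv g) univ z) (hTz : T * deriv g z = 1)
    (hγ : iteratedDeriv 3 g z ≠ 0) :
    IsCubicPoint (charLine g T) (fun y => 1 - T * deriv g y) (fun y => -(T * deriv (deriv g) y))
      (T * |iteratedDeriv 3 g z| / 6) z := by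
  have hg1 : ContDiff ℝ 2 (deriv g) := (contDiff_succ_iff_deriv (n := 2)).1 hg |>.2.2
  have hg2 : ContDiff ℝ 1 (deriv (deriv g)) := (contDiff_succ_iff_deriv (n := 1)).1 hg1 |>.2.2
  have hneg : iteratedDeriv 3 g z < 0 :=
    lt_of_le_of_ne (iteratedDeriv_three_nonpos (hg.of_le (by norm_num)) hz) hγ
  refine ⟨hasDerivAt_charLine (hg.differentiable (by norm_num)) T, fun y => ?_, ?_, ?_, ?_, ?_, ?_⟩
  · simpa using ((hg1.differentiable (by norm_num) y).hasDerivAt.const_mul T).const_sub 1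
  · have := hg2.continuous
    fun_prop
  · refine ((hg2.differentiable one_ne_zero z).hasDerivAt.const_mul T).fun_neg.congr_deriv ?_
    rw [abs_of_neg hneg, iteratedDeriv_three]
    ring
  · rw [hTz, sub_self]
  · have hmax : IsLocalMax (deriv g) z := Eventually.of_forall fun y => hz (mem_univ y)
    rw [hmax.deriv_eq_zero, mul_zero, neg_zero]
  · have := abs_pos.2 hγ
    positivity

/-- A period `[p, p + 1]` whose end points are not critical, so that the maximum points in it
are exactly the ones in `[0, 1)`. -/
theorem exists_period (hp : Function.Periodic g 1)
    (hS : ∀ x, x ∈ S ↔ x ∈ Ico (0 : ℝ) 1 ∧ IsMaxOn g univ x) :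
    ∃ p : ℝ, (∀ z ∈ S, z ∈ Ioo p (p + 1)) ∧
      ∀ y ∈ Icc p (p + 1), IsMaxOn g univ y → y ∈ S := by
  have hev : ∀ᶠ p in 𝓝[<] (0 : ℝ), ∀ z ∈ S, z - 1 < p := by
    rw [Filter.eventually_all_finset]
    exact fun z hz => nhdsWithin_le_nhds (lt_mem_nhds (by linarith [((hS z).1 hz).1.2]))
  have hev2 : ∀ᶠ p in 𝓝[<] (0 : ℝ), p < 0 ∧ -1 < p :=
    (eventually_mem_nhdsWithin (a := (0 : ℝ)) (s := Iio 0)).and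
      (nhdsWithin_le_nhds (lt_mem_nhds (by norm_num)))
  obtain ⟨p, hpS, hp0, hp1⟩ := (hev.and hev2).exists
  refine ⟨p, fun z hz => ⟨hp0.trans_le ((hS z).1 hz).1.1, by linarith [hpS z hz]⟩,
    fun y hy hmax => ?_⟩
  rcases le_or_gt 0 y with h0 | h0
  · exact (hS y).2 ⟨⟨h0, by linarith [hy.2]⟩, hmax⟩
  · have hmax' : IsMaxOn g univ (y + 1) := by
      rw [isMaxOn_iff] at hmax ⊢
      rwa [hp y]
    have := hpS (y + 1) ((hS _).2 ⟨⟨by linarith [hy.1], by linarith⟩, hmax'⟩)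
    linarith [hy.1]

/-- The constants of the stationary phase formula combine to those of `shockAmplitude`. -/
theorem rpow_prefactor {γ k : ℝ} (hT : 0 < T) (hγ : 0 < γ) (hk : 0 < k) :
    (2 * Real.pi * k)⁻¹ * ((2 * Real.pi * k) ^ (-(1 / 3) : ℝ) *
      (2 * Real.pi / (3 * Real.Gamma (2 / 3)) * ((T * γ / 6) ^ (1 / 3 : ℝ))⁻¹)) =
    1 / ((9 * Real.pi * T * γ) ^ (1 / 3 : ℝ) * Real.Gamma (2 / 3)) * k ^ (-(4 / 3) : ℝ) := by
  have hG : 0 < Real.Gamma (2 / 3) := Real.Gamma_pos_of_pos (by norm_num)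
  have hpi := Real.pi_pos
  have h1 : (9 * Real.pi * T * γ) ^ (1 / 3 : ℝ) =
      3 * ((2 * Real.pi) ^ (1 / 3 : ℝ) * (T * γ / 6) ^ (1 / 3 : ℝ)) := by
    rw [← Real.mul_rpow (by positivity) (by positivity),
      show 9 * Real.pi * T * γ = 3 ^ (3 : ℕ) * (2 * Real.pi * (T * γ / 6)) by ring,
      Real.mul_rpow (by positivity) (by positivity), one_div]
    congr 1
    exact Real.pow_rpow_inv_natCast (by norm_num) (by norm_num)
  have h2 : k ^ (-(4 / 3) : ℝ) = k⁻¹ * (k ^ (1 / 3 : ℝ))⁻¹ := by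
    rw [← Real.rpow_neg hk.le, ← Real.rpow_neg_one, ← Real.rpow_add hk]
    norm_num
  have h3 : (2 * Real.pi * k) ^ (-(1 / 3) : ℝ) =
      ((2 * Real.pi) ^ (1 / 3 : ℝ))⁻¹ * (k ^ (1 / 3 : ℝ))⁻¹ := by
    rw [Real.rpow_neg (by positivity), Real.mul_rpow (by positivity) hk.le, mul_inv]
  rw [h1, h2, h3]
  field_simp

/-- The Fourier coefficients at the shock time of a profile transported along the
characteristics. -/
theorem isLittleO_fourierMode {u : ℝ → ℝ} (hg : ContDiff ℝ 3 fun y => f (U₀ y))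
    (hU₀ : ContDiff ℝ 2 U₀) (hUp : Function.Periodic U₀ 1)
    (hT : 0 < shockTime f U₀)
    (hTS : ∀ x, IsMaxOn (deriv fun y => f (U₀ y)) univ x ↔
      shockTime f U₀ * deriv (fun y => f (U₀ y)) x = 1)
    (hS : ∀ x, x ∈ S ↔ x ∈ Ico (0 : ℝ) 1 ∧ IsMaxOn (deriv fun y => f (U₀ y)) univ x)
    (hγ : ∀ x ∈ S, iteratedDeriv 3 (fun y => f (U₀ y)) x ≠ 0)
    (hu : Continuous u) (hup : Function.Periodic u 1)
    (huφ : ∀ y, u (charLine (fun y => f (U₀ y)) (shockTime f U₀) y) = U₀ y) :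
    (fun k : ℕ => fourierMode u k
      - (-Complex.I * shockAmplitude f U₀ S k * (((k : ℝ) ^ (-(4 / 3) : ℝ) : ℝ) : ℂ)))
      =o[atTop] fun k : ℕ => (k : ℝ) ^ (-(4 / 3) : ℝ) := by
  set T := shockTime f U₀ with hTdef
  set g : ℝ → ℝ := fun y => f (U₀ y) with hgdef
  have hgp : Function.Periodic g 1 := fun y => by simp only [hgdef, hUp y]
  have hgd : Differentiable ℝ g := hg.differentiable (by norm_num)
  have hg1 : ContDiff ℝ 2 (deriv g) := (contDiff_succ_iff_deriv (n := 2)).1 hg |>.2.2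
  have hg2 : ContDiff ℝ 1 (deriv (deriv g)) := (contDiff_succ_iff_deriv (n := 1)).1 hg1 |>.2.2
  have hU1 : ContDiff ℝ 1 (deriv U₀) := (contDiff_succ_iff_deriv (n := 1)).1 hU₀ |>.2.2
  have hUd : ∀ y, HasDerivAt U₀ (deriv U₀ y) y := fun y =>
    (hU₀.differentiable (by norm_num) y).hasDerivAt
  set φ := charLine g T with hφ
  have hφ1 : ∀ y, φ (y + 1) = φ y + 1 := charLine_add_one hgp T
  obtain ⟨p, hpS, hpc⟩ := exists_period (periodic_deriv hgp) hS
  set κ : ℝ → ℝ := fun z => T * |iteratedDeriv 3 g z| / 6 with hκ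
  have hκpos : ∀ z ∈ S, 0 < κ z := fun z hz => by
    have := abs_pos.2 (hγ z hz)
    simp only [hκ]; positivity
  have hphase := isLittleO_integral_sub_sum (φ := φ) (φ₁ := fun y => 1 - T * deriv g y)
    (φ₂ := fun y => -(T * deriv (deriv g) y)) (a := deriv U₀) (a₁ := deriv (deriv U₀)) (κ := κ)
    (hasDerivAt_charLine hgd T)
    (fun y => by
      simpa using ((hg1.differentiable (by norm_num) y).hasDerivAt.const_mul T).const_sub 1)
    (by have := hg2.continuous; fun_prop)
    (fun y => (hU1.differentiable one_ne_zero y).hasDerivAt)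
    (hU1.continuous_deriv le_rfl) (p := p) S (p + 1) (by linarith)
    (fun z hz => isCubicPoint_charLine hg hT ((hS z).1 hz).2 ((hTS z).1 ((hS z).1 hz).2) (hγ z hz))
    hpS
    (fun y hy hyS h0 => hyS (hpc y hy ((hTS y).2 (by linarith))))
  -- specialize the frequency to `2 π k`
  set t : ℕ → ℝ := fun k => (2 * Real.pi * k) ^ (-(1 / 3) : ℝ) with ht
  have hbase : Tendsto (fun k : ℕ => 2 * Real.pi * (k : ℝ)) atTop atTop :=
    tendsto_natCast_atTop_atTop.const_mul_atTop (by positivity)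
  have htt : Tendsto t atTop (𝓝[>] 0) := by
    refine tendsto_nhdsWithin_iff.2
      ⟨(tendsto_rpow_neg_atTop (by norm_num : (0 : ℝ) < 1 / 3)).comp hbase, ?_⟩
    filter_upwards [hbase.eventually_gt_atTop 0] with k hk
    exact Real.rpow_pos_of_pos hk _
  have hcomp := hphase.comp_tendsto htt
  have hr : (fun k : ℕ => (Complex.I * (2 * Real.pi * k : ℝ))⁻¹) =O[atTop]
      fun k : ℕ => (2 * Real.pi * k)⁻¹ := by
    refine IsBigO.of_bound 1 (Eventually.of_forall fun k => ?_)
    rw [norm_inv, norm_mul, Complex.norm_I, one_mul, one_mul, Complex.norm_real, norm_inv]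
  have hmul := hr.mul_isLittleO hcomp
  have hscale : (fun k : ℕ => (2 * Real.pi * k)⁻¹ * t k) =O[atTop]
      fun k : ℕ => (k : ℝ) ^ (-(4 / 3) : ℝ) := by
    refine IsBigO.of_bound ((2 * Real.pi) ^ (-(4 / 3) : ℝ)) ?_
    filter_upwards [eventually_gt_atTop 0] with k hk
    have hk' : (0 : ℝ) < k := by exact_mod_cast hk
    rw [Real.norm_of_nonneg (by positivity), Real.norm_of_nonneg (by positivity),
      ← Real.mul_rpow (by positivity) hk'.le, ht, ← Real.rpow_neg_one,
      ← Real.rpow_add (by positivity)]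
    norm_num
  refine (hmul.trans_isBigO hscale).congr' ?_ EventuallyEq.rfl
  filter_upwards [eventually_gt_atTop 0] with k hk
  have hk' : (0 : ℝ) < k := by exact_mod_cast hk
  have ht3 : (t k ^ 3)⁻¹ = 2 * Real.pi * k := by
    rw [ht, ← Real.rpow_natCast, ← Real.rpow_mul (by positivity)]
    norm_num [Real.rpow_neg_one]
  simp only [Function.comp_apply, ht3]
  rw [fourierMode_eq_integral_deriv (φ := φ) (φ₁ := fun y => 1 - T * deriv g y) hu hup
    (hasDerivAt_charLine hgd T) (by have := hg1.continuous; fun_prop) hφ1 huφ hUd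
    hU1.continuous (by simpa using hUp 0) hk.ne']
  have hper : Function.Periodic (fun y : ℝ => ((deriv U₀ y : ℝ) : ℂ) *
      Complex.exp (-(Complex.I * (2 * Real.pi * k : ℝ) * φ y))) 1 := fun y => by
    simp only [periodic_deriv hUp y, hφ1, exp_neg_I_mul_add_one]
  have hshift := hper.intervalIntegral_add_eq 0 p
  rw [zero_add] at hshift
  rw [hshift, mul_sub]
  congr 1
  rw [shockAmplitude, Finset.mul_sum, Finset.mul_sum, Finset.mul_sum, Finset.sum_mul]
  refine Finset.sum_congr rfl fun z hz => ?_
  have hpre := rpow_prefactor hT (abs_pos.2 (hγ z hz)) hk'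
  rw [two_mul_re_cubicFresnel (hκpos z hz)]
  have hexp : -(Complex.I * (2 * Real.pi * k : ℝ) * (φ z : ℂ)) =
      -(2 * Real.pi * Complex.I * k * ((z - T * f (U₀ z) : ℝ) : ℂ)) := by
    rw [hφ, charLine]; push_cast; ring
  rw [hexp]
  set E := Complex.exp (-(2 * Real.pi * Complex.I * k * ((z - T * f (U₀ z) : ℝ) : ℂ)))
  have hinv : (Complex.I * ((2 * Real.pi * k : ℝ) : ℂ))⁻¹ =
      -Complex.I * (((2 * Real.pi * k)⁻¹ : ℝ) : ℂ) := by
    rw [mul_inv, Complex.inv_I, Complex.ofReal_inv]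
  rw [hinv]
  calc _ = -Complex.I * E * ((deriv U₀ z * ((2 * Real.pi * k)⁻¹ * (t k *
        (2 * Real.pi / (3 * Real.Gamma (2 / 3)) * ((κ z) ^ (1 / 3 : ℝ))⁻¹))) : ℝ) : ℂ) := by
        push_cast; ring
    _ = _ := by
        rw [ht, hκ, hpre]
        push_cast
        ring

theorem shockAmplitude_eq_sum_mul_pow (f U₀ : ℝ → ℝ) (S : Finset ℝ) (k : ℕ) :
    shockAmplitude f U₀ S k = ∑ y ∈ S,
      ((deriv U₀ y /
        ((9 * Real.pi * shockTime f U₀ * |iteratedDeriv 3 (fun x => f (U₀ x)) y|) ^ (1 / 3 : ℝ)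
          * Real.Gamma (2 / 3)) : ℝ) : ℂ) *
      Complex.exp (-(2 * Real.pi * Complex.I *
        ((charLine (fun x => f (U₀ x)) (shockTime f U₀) y : ℝ) : ℂ))) ^ k := by
  rw [shockAmplitude]
  refine Finset.sum_congr rfl fun y _ => ?_
  rw [← Complex.exp_nat_mul]
  congr 2
  rw [charLine]
  ring

theorem norm_exp_neg_two_pi_I_mul (x : ℝ) :
    ‖Complex.exp (-(2 * Real.pi * Complex.I * (x : ℂ)))‖ = 1 := by
  rw [show -(2 * Real.pi * Complex.I * (x : ℂ)) = ((-(2 * Real.pi * x) : ℝ) : ℂ) * Complex.I by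
    push_cast; ring, Complex.norm_exp_ofReal_mul_I]

/-- Distinct points of a period are carried to distinct points of the circle. -/
theorem NonCrossing.injOn_exp_charLine (h : NonCrossing g T) {s : Set ℝ}
    (hs : s ⊆ Ico (0 : ℝ) 1) :
    InjOn (fun y => Complex.exp (-(2 * Real.pi * Complex.I * ((charLine g T y : ℝ) : ℂ)))) s := by
  intro y hy y' hy' heq
  obtain ⟨n, hn⟩ := Complex.exp_eq_exp_iff_exists_int.1 heq
  have hne : (2 * Real.pi * Complex.I : ℂ) ≠ 0 := Complex.two_pi_I_ne_zero
  have h1 : ((charLine g T y : ℝ) : ℂ) = ((charLine g T y' - n : ℝ) : ℂ) := by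
    apply mul_left_cancel₀ hne
    push_cast
    linear_combination -hn
  have h2 : charLine g T y = charLine g T (y' - n) := by
    have hgn : g (y' - n) = g y' := by simpa using h.periodic.sub_int_mul_eq n (x := y')
    rw [Complex.ofReal_inj.1 h1, charLine, charLine, hgn]
    ring
  have h3 : y = y' - n := (h.strictMono ⟨h.pos.le, le_rfl⟩).injective h2
  have hy1 := hs hy
  have hy2 := hs hy'
  have hn1 : (n : ℝ) < 1 := by linarith [hy1.1, hy2.2]
  have hn2 : (-1 : ℝ) < n := by linarith [hy1.2, hy2.1]
  have : n = 0 := by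
    have h4 : n < 1 := by exact_mod_cast hn1
    have h5 : -1 < n := by exact_mod_cast hn2
    omega
  rw [h3, this]; simp

end Assembly

theorem mainTheorem1 (f U₀ : ℝ → ℝ) (hf : ContDiff ℝ 3 f)
    (M : ℕ) (c : ℤ → ℂ) (hc : c 0 = 0)
    (hU₀ : ∀ x : ℝ, (U₀ x : ℂ) =
      ∑ n ∈ Finset.Icc (-(M : ℤ)) (M : ℤ), c n * Complex.exp (2 * Real.pi * Complex.I * n * x))
    (S : Finset ℝ)
    (hS : ∀ x : ℝ, x ∈ S ↔
      x ∈ Ico (0 : ℝ) 1 ∧ IsMaxOn (deriv fun y => f (U₀ y)) univ x)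
    (hγ : ∀ x ∈ S, iteratedDeriv 3 (fun y => f (U₀ y)) x ≠ 0) :
    0 < shockTime f U₀ ∧
    (∃ U : ℝ → ℝ → ℝ, IsBurgersSolution f U₀ (shockTime f U₀) U) ∧
    ∀ U : ℝ → ℝ → ℝ, IsBurgersSolution f U₀ (shockTime f U₀) U →
      -- asymptotics of the Fourier coefficients and of the spectrum, with the explicit prefactor
      ((fun k : ℕ => fourierMode (U (shockTime f U₀)) k
          - (-Complex.I * shockAmplitude f U₀ S k * (((k : ℝ) ^ (-(4 / 3) : ℝ) : ℝ) : ℂ)))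
        =o[atTop] fun k : ℕ => (k : ℝ) ^ (-(4 / 3) : ℝ)) ∧
      ((fun k : ℕ => ‖fourierMode (U (shockTime f U₀)) k‖ ^ 2
          - ‖shockAmplitude f U₀ S k‖ ^ 2 * (k : ℝ) ^ (-(8 / 3) : ℝ))
        =o[atTop] fun k : ℕ => (k : ℝ) ^ (-(8 / 3) : ℝ)) ∧
      -- the ratio tends to one wherever the amplitude stays away from zero
      (∀ δ : ℝ, 0 < δ →
        (fun k : ℕ => ‖fourierMode (U (shockTime f U₀)) k‖ ^ 2)
          ~[atTop ⊓ 𝓟 {k : ℕ | δ ≤ ‖shockAmplitude f U₀ S k‖}]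
        fun k : ℕ => ‖shockAmplitude f U₀ S k‖ ^ 2 * (k : ℝ) ^ (-(8 / 3) : ℝ)) ∧
      -- in particular for all large `k` when there is a single maximum point
      (S.card = 1 →
        (fun k : ℕ => ‖fourierMode (U (shockTime f U₀)) k‖ ^ 2)
          ~[atTop]
        fun k : ℕ => ‖shockAmplitude f U₀ S k‖ ^ 2 * (k : ℝ) ^ (-(8 / 3) : ℝ)) ∧
      -- the size is `k ^ (-8/3)`: upper bound for all large `k`, lower bound for at least one
      -- of any `S.card` consecutive large values of `k`
      (∃ a b : ℝ, 0 < a ∧ 0 < b ∧ ∀ᶠ k : ℕ in atTop,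
        ‖fourierMode (U (shockTime f U₀)) k‖ ^ 2 ≤ b * (k : ℝ) ^ (-(8 / 3) : ℝ) ∧
        ∃ i < S.card, a * ((k + i : ℕ) : ℝ) ^ (-(8 / 3) : ℝ)
          ≤ ‖fourierMode (U (shockTime f U₀)) (k + i)‖ ^ 2) := by
  have hU3 : ContDiff ℝ 3 U₀ := contDiff_of_trigPolynomial hU₀ 3
  have hUp : Function.Periodic U₀ 1 := periodic_of_trigPolynomial hU₀
  set g : ℝ → ℝ := fun y => f (U₀ y) with hgdef
  have hg : ContDiff ℝ 3 g := hf.comp hU3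
  have hg1 : ContDiff ℝ 1 g := hg.of_le (by norm_num)
  have hf1 : ContDiff ℝ 1 f := hf.of_le (by norm_num)
  have hgp : Function.Periodic g 1 := fun y => by simp only [hgdef, hUp y]
  obtain ⟨x₀, hx₀⟩ := exists_isMaxOn_of_periodic (hg1.continuous_deriv le_rfl)
    (periodic_deriv hgp)
  have hsup := iSup_eq_of_isMaxOn hx₀
  have hpos : 0 < deriv g x₀ := hsup ▸ iSup_deriv_pos hg1 hgp hS
  have hTeq : shockTime f U₀ = (deriv g x₀)⁻¹ := by rw [shockTime, hsup]
  have hT : 0 < shockTime f U₀ := by rw [hTeq]; exact inv_pos.2 hpos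
  have hle : ∀ y, shockTime f U₀ * deriv g y ≤ 1 := fun y => by
    rw [hTeq, inv_mul_le_one₀ hpos]
    exact hx₀ (mem_univ y)
  have hTS : ∀ x, IsMaxOn (deriv g) univ x ↔ shockTime f U₀ * deriv g x = 1 := by
    intro x
    rw [hTeq, inv_mul_eq_one₀ hpos.ne', isMaxOn_iff]
    exact ⟨fun h => le_antisymm (h x₀ (mem_univ _)) (hx₀ (mem_univ x)),
      fun h y hy => h ▸ hx₀ hy⟩
  have hNC : NonCrossing g (shockTime f U₀) := by
    refine ⟨hg1, hgp, hT, hle, fun α β hαβ => ?_⟩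
    obtain ⟨y, hy, hny⟩ := exists_mem_Ioo_not_isMaxOn (periodic_deriv hgp) hS hαβ
    exact ⟨y, hy, lt_of_le_of_ne (hle y) fun h => hny ((hTS y).2 h)⟩
  refine ⟨hT, ⟨_, isBurgersSolution_charFoot hNC (hU3.of_le (by norm_num)) hUp⟩, fun U hU => ?_⟩
  have hmemT : shockTime f U₀ ∈ Icc 0 (shockTime f U₀) := ⟨hT.le, le_rfl⟩
  have hucont : Continuous (U (shockTime f U₀)) :=
    hU.continuousOn.comp_continuous (f := fun x : ℝ => (shockTime f U₀, x)) (by fun_prop)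
      fun x => ⟨hmemT, mem_univ _⟩
  have hasymp := isLittleO_fourierMode (f := f) hg (hU3.of_le (by norm_num)) hUp hT hTS hS hγ
    hucont (hU.periodic _ hmemT) (hU.apply_charLine hf1 hNC)
  -- the amplitude is an exponential sum with distinct frequencies and nonzero coefficients
  set b : ℝ → ℂ := fun y => ((deriv U₀ y /
    ((9 * Real.pi * shockTime f U₀ * |iteratedDeriv 3 g y|) ^ (1 / 3 : ℝ)
      * Real.Gamma (2 / 3)) : ℝ) : ℂ) with hb
  set v : ℝ → ℂ := fun y => Complex.exp (-(2 * Real.pi * Complex.I *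
    ((charLine g (shockTime f U₀) y : ℝ) : ℂ))) with hv
  have hA : ∀ k, shockAmplitude f U₀ S k = ∑ y ∈ S, b y * v y ^ k :=
    shockAmplitude_eq_sum_mul_pow f U₀ S
  have hv1 : ∀ y, ‖v y‖ = 1 := fun y => norm_exp_neg_two_pi_I_mul _
  have hAC : ∀ k, ‖shockAmplitude f U₀ S k‖ ≤ ∑ y ∈ S, ‖b y‖ := fun k => by
    rw [hA]
    refine (norm_sum_le _ _).trans (Finset.sum_le_sum fun y _ => ?_)
    rw [norm_mul, norm_pow, hv1, one_pow, mul_one]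
  have hb0 : ∀ y ∈ S, b y ≠ 0 := by
    intro y hy
    have hγ' := abs_pos.2 (hγ y hy)
    have hG : 0 < Real.Gamma (2 / 3) := Real.Gamma_pos_of_pos (by norm_num)
    have hpi := Real.pi_pos
    refine Complex.ofReal_ne_zero.2 (div_ne_zero (fun h0 => ?_) (by positivity))
    -- `g' = f'(U₀) U₀'` is positive at a maximum point
    have hchain : deriv g y = deriv f (U₀ y) * deriv U₀ y :=
      deriv_comp y (hf1.differentiable one_ne_zero _) (hU3.differentiable (by norm_num) y)
    have h1 := (hTS y).1 ((hS y).1 hy).2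
    rw [hchain, h0, mul_zero, mul_zero] at h1
    exact zero_ne_one h1
  have hSne : S.Nonempty := by
    refine ⟨Int.fract x₀, (hS _).2 ⟨⟨Int.fract_nonneg _, Int.fract_lt_one _⟩, ?_⟩⟩
    exact (isMaxOn_fract_iff (periodic_deriv hgp) x₀).2 hx₀
  obtain ⟨c₀, hc₀, hlow⟩ := exists_le_norm_sum_mul_pow hSne
    (hNC.injOn_exp_charLine fun y hy => ((hS y).1 hy).1) (fun y _ => hv1 y) hb0
  have hlow' : ∀ k, ∃ i < S.card, c₀ ≤ ‖shockAmplitude f U₀ S (k + i)‖ := fun k => by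
    simpa only [hA] using hlow k
  have hsq := isLittleO_normSq_sub hasymp hAC
  refine ⟨hasymp, hsq, fun δ hδ => isEquivalent_normSq hsq hδ, fun hcard => ?_,
    exists_bounds_normSq hsq hAC hc₀ hlow'⟩
  have huniv : {k : ℕ | c₀ ≤ ‖shockAmplitude f U₀ S k‖} = univ := by
    refine eq_univ_of_forall fun k => ?_
    obtain ⟨i, hi, hci⟩ := hlow' k
    rw [hcard, Nat.lt_one_iff] at hi
    simpa [hi] using hci
  have h := isEquivalent_normSq hsq hc₀
  rwa [huniv, principal_univ, inf_top_eq] at h
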